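/- Let $r\ge 2$ and $1\le \ell\le r$ be integers, let $P_\ell(x_1,\dots,x_r)=\sum_{1\le i_1<\dots<i_\ell\le r}x_{i_1}\cdots x_{i_\ell}$ be the $\ell$-th elementary symmetric polynomial, and for $n\ge\binom r\ell$ let $$H_{\ell,r}(n)=\{(i_1,\dots,i_r)\in\mathbb N^r:\ P_\ell(i_1,\dots,i_r)\le n\},\qquad \mathbb N=\{1,2,\dots\}.$$ Let $U_{\ell,r}$ be a random variable which, if $\ell=r$, is uniformly distributed on $[0,1]$ and, if $\ell<r$, has the distribution function $$\mathbb P\{U_{\ell,r}\le x\}=\frac{\mathrm{Vol}\{y\in[0,\infty)^r:\ P_\ell(y)\le 1,\ y_1\cdots y_r\le x\}}{\mathrm{Vol}\{y\in[0,\infty)^r:\ P_\ell(y)\le 1\}},\qquad x\in\mathbb R,$$ where $\mathrm{Vol}$ is $r$-dimensional Lebesgue measure. Let $\mathcal G_k(p)$, for $k=1,\dots,r$ and $p$ in the set $\mathcal P$ of primes, be mutually independent random variables with $\mathbb P\{\mathcal G_k(p)=j\}=(1-\frac1p)\,p^{-j}$ for $j=0,1,2,\dots$. Let $f:[0,\infty)\to\mathbb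 R$ be a locally bounded function which is regularly varying at $\infty$ with index $\beta>0$; that is, $f$ is (Lebesgue) measurable in a neighbourhood of $+\infty$ and $\lim_{t\to\infty}f(\lambda t)/f(t)=\lambda^\beta$ for every $\lambda>0$. Then, as $n\to\infty$, $$\frac1{|H_{\ell,r}(n)|}\sum_{(i_1,\dots,i_r)\in H_{\ell,r}(n)}f(\mathrm{LCM}(i_1,\dots,i_r))\ \sim\ \mathbb E\bigl(U_{\ell,r}^{\beta}\bigr)\;\mathbb E\Biggl(\biggl(\prod_{p\in\mathcal P}p^{\max_{1\le k\le r}\mathcal G_k(p)-\sum_{k=1}^r\mathcal G_k(p)}\biggr)^{\beta}\Biggr)\,f(n^{r/\ell}),$$ where $a_n\sim b_n$ means $\lim_{n\to\infty}a_n/b_n=1$. -/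

import Mathlib

open MeasureTheory ProbabilityTheory Filter Topology

noncomputable section

namespace HyperbolicLCM

/-- The `l`-th standard (elementary) symmetric polynomial in `r` variables, evaluated at `x`. -/
def symmP {R : Type*} [CommSemiring R] {r : ℕ} (l : ℕ) (x : Fin r → R) : R :=
  MvPolynomial.eval x (MvPolynomial.esymm (Fin r) R l)

theorem symmP_eq_sum {R : Type*} [CommSemiring R] {r : ℕ} (l : ℕ) (x : Fin r → R) :
    symmP l x = ∑ s ∈ Finset.powersetCard l Finset.univ, ∏ k ∈ s, x k := by
  simp [symmP, MvPolynomial.esymm]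

/-- The discrete hyperbolic region: all `i` with positive integer coordinates and `P_l(i) ≤ n`.
The bound `i k ≤ n` is automatic when `1 ≤ l ≤ r` (see `mem_region`); it makes the set a finset. -/
def region (l r n : ℕ) : Finset (Fin r → ℕ) :=
  (Fintype.piFinset fun _ => Finset.Icc 1 n).filter fun i => symmP l i ≤ n

theorem mem_region {l r n : ℕ} (hl : 1 ≤ l) (hlr : l ≤ r) (i : Fin r → ℕ) :
    i ∈ region l r n ↔ (∀ k, 1 ≤ i k) ∧ symmP l i ≤ n := by
  simp only [region, Finset.mem_filter, Fintype.mem_piFinset, Finset.mem_Icc]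
  refine ⟨fun h => ⟨fun k => (h.1 k).1, h.2⟩, fun h => ⟨fun k => ⟨h.1 k, ?_⟩, h.2⟩⟩
  obtain ⟨s, hks, -, hs⟩ := Finset.exists_subsuperset_card_eq
    (Finset.subset_univ ({k} : Finset (Fin r))) (n := l) (by simpa using hl) (by simpa using hlr)
  have hk : k ∈ s := hks (Finset.mem_singleton_self k)
  calc i k ≤ ∏ j ∈ s, i j :=
        Finset.single_le_prod' (f := i) (fun j _ => h.1 j) hk
    _ ≤ ∑ s ∈ Finset.powersetCard l Finset.univ, ∏ j ∈ s, i j :=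
        Finset.single_le_sum (f := fun s : Finset (Fin r) => ∏ j ∈ s, i j)
          (fun _ _ => Nat.zero_le _) (by simp [Finset.mem_powersetCard, hs])
    _ = symmP l i := (symmP_eq_sum l i).symm
    _ ≤ n := h.2

/-- The average of `f(LCM(i_1, …, i_r))` over the discrete hyperbolic region. -/
def lcmAverage (f : ℝ → ℝ) (l r n : ℕ) : ℝ :=
  (∑ i ∈ region l r n, f ((Finset.univ.lcm i : ℕ) : ℝ)) / ((region l r n).card : ℝ)

/-- The continuous hyperbolic region: all `y ∈ [0, ∞)^r` with `P_l(y) ≤ c`. -/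
def contRegion (l r : ℕ) (c : ℝ) : Set (Fin r → ℝ) :=
  {y | (∀ k, 0 ≤ y k) ∧ symmP l y ≤ c}

theorem measurable_symmP (l r : ℕ) : Measurable fun y : Fin r → ℝ => symmP l y := by
  simp only [symmP_eq_sum]
  fun_prop

theorem measurableSet_contRegion (l r : ℕ) (c : ℝ) : MeasurableSet (contRegion l r c) := by
  have h : contRegion l r c = (⋂ k, {y | 0 ≤ y k}) ∩ {y | symmP l y ≤ c} := by
    ext y; simp [contRegion]
  rw [h]
  exact (MeasurableSet.iInter fun k => measurableSet_le measurable_const (measurable_pi_apply k)).inter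
    (measurableSet_le (measurable_symmP l r) measurable_const)

/-- The law of `U_{l,r}`. For `l < r` it is the law of the product of the coordinates of a
uniformly distributed point of the continuous region with `c = 1` (its distribution function is
computed in `limitLaw_Iic`); for `l = r` it is the uniform distribution on `[0, 1]`. -/
def limitLaw (l r : ℕ) : Measure ℝ :=
  if l < r then
    (ProbabilityTheory.cond (volume : Measure (Fin r → ℝ)) (contRegion l r 1)).map
      fun y => ∏ k, y k
  else ProbabilityTheory.cond volume (Set.Icc (0 : ℝ) 1)

theorem limitLaw_Iic {l r : ℕ} (hlr : l < r) (x : ℝ) :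
    limitLaw l r (Set.Iic x) =
      volume {y : Fin r → ℝ | ((∀ k, 0 ≤ y k) ∧ symmP l y ≤ 1) ∧ ∏ k, y k ≤ x} /
        volume {y : Fin r → ℝ | (∀ k, 0 ≤ y k) ∧ symmP l y ≤ 1} := by
  rw [limitLaw, if_pos hlr, Measure.map_apply (by fun_prop) measurableSet_Iic,
    cond_apply (measurableSet_contRegion l r 1), mul_comm, ← div_eq_mul_inv]
  rfl

/-- The geometric law on `{0, 1, 2, …}` with `P{j} = (1 - 1/p) / p ^ j`
(see `geomLaw_singleton`). -/
def geomLaw (p : Nat.Primes) : Measure ℕ :=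
  geometricMeasure (unitInterval.symm
    ⟨((p : ℕ) : ℝ)⁻¹, by positivity, inv_le_one_of_one_le₀ (by exact_mod_cast p.2.one_le)⟩)

theorem geomLaw_singleton (p : Nat.Primes) (j : ℕ) :
    geomLaw p {j} = ENNReal.ofReal ((1 - 1 / ((p : ℕ) : ℝ)) * (1 / ((p : ℕ) : ℝ) ^ j)) := by
  rw [geomLaw, geometricMeasure_singleton]
  · congr 1
    simp [unitInterval.coe_symm_eq, mul_comm]
  · intro h
    have h2 := congrArg Subtype.val h
    simp only [unitInterval.coe_symm_eq, Set.Icc.coe_zero, sub_eq_zero] at h2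
    have h3 : ((p : ℕ) : ℝ) = 1 := by simpa using h2.symm
    exact p.2.one_lt.ne' (by exact_mod_cast h3)

/-- The infinite product over the primes `p` of `p ^ (max_k g k p - ∑_k g k p)`. -/
def primeProduct {r : ℕ} (g : Fin r → Nat.Primes → ℕ) : ℝ :=
  ∏' p : Nat.Primes, ((p : ℕ) : ℝ) ^
    (((Finset.univ.sup fun k => g k p : ℕ) : ℤ) - ∑ k, (g k p : ℤ))

/-- `f` is regularly varying at `∞` with index `β`: it is (Lebesgue) measurable in a neighbourhood
of `∞`, and `f (c t) / f t → c ^ β` as `t → ∞`, for all `c > 0`. -/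
def RegularlyVarying (f : ℝ → ℝ) (β : ℝ) : Prop :=
  (∃ A : ℝ, AEMeasurable f (volume.restrict (Set.Ioi A))) ∧
    ∀ c : ℝ, 0 < c → Tendsto (fun t => f (c * t) / f t) atTop (𝓝 (c ^ β))

/-- `f` is locally bounded on `[0, ∞)`: each point of `[0, ∞)` has a relative neighbourhood on which
`f` is bounded. -/
def LocallyBounded (f : ℝ → ℝ) : Prop :=
  ∀ x : ℝ, 0 ≤ x → ∃ V ∈ 𝓝[Set.Ici 0] x, Bornology.IsBounded (f '' V)

end HyperbolicLCM

end

/-! Write LCM(i) as the product of the coordinates times `lcmRatio i`, and put t = n^(r/l). The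
product is at most t on the region, so LCM(i)/t lies in (0, 1], where f(ct)/f(t) is uniformly close
to c^β (`RegularlyVarying.uniform`). The problem becomes the limit of the mean of (LCM/t)^β.

The size (product/t)^β has limiting mean E(U^β) (`tendsto_moment`). For l < r the continuous region
has finite volume and lattice sums are Riemann sums. For l = r the volume is infinite; summing along
one coordinate gives the uniform law, with an error of the order of the hyperbola one dimension
lower, which is negligible because the harmonic series diverges.

The arithmetic factor `lcmRatio i` is, outside a set of small density, a function of i modulo Q =
`truncModulus m` (`lcmRatio_gcd`, `IsDown.card_exceptional_le`). The region is closed under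
decreasing coordinates, so monotone weights on it are equidistributed modulo Q up to points near the
coordinate hyperplanes (`IsDown.equidistribution`, `tendsto_slab`). Hence size and arithmetic
decouple and the limit is a product of two means.

Finally, the gcd with Q of a uniform residue modulo Q has the law of an integer built from truncated
geometric exponents, so the mean over residues is an expectation (`integral_truncPoint`). By
Borel-Cantelli only finitely many primes divide two of the random coordinates, so the truncations
stabilise to the prime product, and dominated convergence lets m tend to infinity. -/

namespace HyperbolicLCM

/-! ### Regular variation: Potter bounds and uniformity on (0, 1]. -/

/-- The uniform convergence theorem for additively slowly varying functions. -/
theorem uniform_of_slowlyVarying {k : ℝ → ℝ} (hk : AEMeasurable k)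
    (h : ∀ u, Tendsto (fun x => k (x + u) - k x) atTop (𝓝 0)) {ε : ℝ} (hε : 0 < ε) :
    ∃ X, ∀ x ≥ X, ∀ u ∈ Set.Icc (0 : ℝ) 1, |k (x + u) - k x| ≤ ε := by
  -- The increments v for which k has not yet settled. Pointwise convergence on the finite measure
  -- space [0, 2] gives convergence in measure, so these sets shrink.
  set B : ℝ → Set ℝ := fun x => {v | ε / 2 ≤ |k (x + v) - k x|} with hB
  have hlim : Tendsto (fun x => volume (B x ∩ Set.Icc 0 2)) atTop (𝓝 0) := by
    refine tendsto_of_seq_tendsto fun y hy => ?_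
    have hm : TendstoInMeasure (volume.restrict (Set.Icc (0 : ℝ) 2))
        (fun n v => k (y n + v) - k (y n)) atTop (fun _ => 0) := by
      refine tendstoInMeasure_of_tendsto_ae (fun n => ?_) (ae_of_all _ fun v => (h v).comp hy)
      have h1 : AEMeasurable (fun v => k (y n + v)) :=
        hk.comp_quasiMeasurePreserving
          (measurePreserving_add_left volume (y n)).quasiMeasurePreserving
      exact ((h1.sub_const _).restrict).aestronglyMeasurable
    have := hm (ENNReal.ofReal (ε / 2)) (by simpa using hε)
    refine this.congr fun n => ?_
    rw [Measure.restrict_apply' measurableSet_Icc]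
    congr 2
    ext v
    simp only [hB, Set.mem_ofPred_eq, edist_dist, Real.dist_eq, sub_zero]
    exact ENNReal.ofReal_le_ofReal_iff (abs_nonneg _)
  have hev : ∀ᶠ x in atTop, volume (B x ∩ Set.Icc 0 2) < 1 / 2 :=
    hlim.eventually (gt_mem_nhds (by simp))
  obtain ⟨X, hX⟩ := eventually_atTop.1 hev
  refine ⟨X, fun x hx u hu => ?_⟩
  -- For v in [1, 2] and u in [0, 1], both v and v - u stay in [0, 2]. The two bad sets have total
  -- measure below 1, so some v is good from x and from x + u; k(x + v) is then within ε/2 of both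
  -- values.
  have hgood : ∃ v ∈ Set.Icc (1 : ℝ) 2, v ∉ B x ∧ v + -u ∉ B (x + u) := by
    by_contra! hcon
    have hsub : Set.Icc (1 : ℝ) 2 ⊆ (B x ∩ Set.Icc 0 2) ∪
        (fun v => v + -u) ⁻¹' (B (x + u) ∩ Set.Icc 0 2) := by
      intro v hv
      by_cases hvB : v ∈ B x
      · exact Or.inl ⟨hvB, by linarith [hv.1], hv.2⟩
      · exact Or.inr ⟨hcon v hv hvB, by linarith [hv.1, hu.2], by linarith [hv.2, hu.1]⟩
    have h1 : volume (Set.Icc (1 : ℝ) 2) < 1 := by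
      calc volume (Set.Icc (1 : ℝ) 2) ≤ _ := measure_mono hsub
        _ ≤ _ := measure_union_le _ _
        _ = volume (B x ∩ Set.Icc 0 2) + volume (B (x + u) ∩ Set.Icc 0 2) := by
            rw [measure_preimage_add_right]
        _ < 1 / 2 + 1 / 2 := ENNReal.add_lt_add (hX x hx) (hX _ (by linarith [hu.1]))
        _ = 1 := ENNReal.add_halves 1
    rw [Real.volume_Icc] at h1
    norm_num at h1
  obtain ⟨v, -, h1, h2⟩ := hgood
  simp only [hB, Set.mem_ofPred_eq, not_le] at h1 h2
  have h3 : x + u + (v + -u) = x + v := by ring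
  rw [h3] at h2
  rw [abs_le]
  constructor <;> linarith [abs_lt.1 h1, abs_lt.1 h2]

/-- Potter's bound for additively slowly varying functions. -/
theorem potter_of_uniform {k : ℝ → ℝ} {ε X : ℝ}
    (h : ∀ x ≥ X, ∀ u ∈ Set.Icc (0 : ℝ) 1, |k (x + u) - k x| ≤ ε)
    {x u : ℝ} (hx : X ≤ x) (hu : 0 ≤ u) : |k (x + u) - k x| ≤ ε * (u + 1) := by
  have hε : 0 ≤ ε := (abs_nonneg _).trans (h x hx 0 (by simp))
  have key : ∀ n : ℕ, |k (x + n) - k x| ≤ ε * n := by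
    intro n
    induction n with
    | zero => simp
    | succ n ih =>
      have h1 := h (x + n) (by have : (0 : ℝ) ≤ n := n.cast_nonneg; linarith) 1 (by simp)
      have h2 : x + n + 1 = x + ((n + 1 : ℕ) : ℝ) := by push_cast; ring
      rw [h2] at h1
      rw [abs_le] at *
      push_cast at *
      constructor <;> linarith
  have h1 := key ⌊u⌋₊
  have hfl := Nat.floor_le hu
  have hfl2 := (Nat.lt_floor_add_one u).le
  have h2 := h (x + ⌊u⌋₊) (by have : (0 : ℝ) ≤ ⌊u⌋₊ := Nat.cast_nonneg _; linarith) (u - ⌊u⌋₊)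
    ⟨by linarith, by linarith⟩
  have h3 : x + ⌊u⌋₊ + (u - ⌊u⌋₊) = x + u := by ring
  rw [h3] at h2
  have h4 : ε * ⌊u⌋₊ ≤ ε * u := mul_le_mul_of_nonneg_left hfl hε
  rw [abs_le] at *
  constructor <;> linarith

/-- The point is that `exp` pulls null sets back to null sets: the preimage is the image under
`log`, differentiable on the positive reals, of a null set. -/
theorem aemeasurable_comp_exp {f : ℝ → ℝ} (hf : AEMeasurable f) :
    AEMeasurable fun x => f (Real.exp x) := by
  refine hf.comp_quasiMeasurePreserving ⟨Real.measurable_exp, ?_⟩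
  refine Measure.AbsolutelyContinuous.mk fun s hs h0 => ?_
  rw [Measure.map_apply Real.measurable_exp hs]
  have h1 : Real.exp ⁻¹' s ⊆ Real.log '' (s ∩ Set.Ioi 0) := fun x hx =>
    ⟨Real.exp x, ⟨hx, Real.exp_pos x⟩, Real.log_exp x⟩
  refine measure_mono_null h1 ?_
  refine addHaar_image_eq_zero_of_differentiableOn_of_addHaar_eq_zero volume ?_
    (measure_mono_null Set.inter_subset_left h0)
  intro x hx
  exact (Real.differentiableAt_log (ne_of_gt hx.2)).differentiableWithinAt

theorem LocallyBounded.exists_bound {f : ℝ → ℝ} (hf : LocallyBounded f) (T : ℝ) :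
    ∃ B, ∀ x ∈ Set.Icc 0 T, |f x| ≤ B := by
  have : Bornology.IsBounded (f '' Set.Icc 0 T) := by
    refine (isCompact_Icc (a := (0 : ℝ)) (b := T)).induction_on
      (p := fun s => Bornology.IsBounded (f '' s)) ?_ ?_ ?_ ?_
    · simp
    · intro s t hst ht
      exact ht.subset (Set.image_mono hst)
    · intro s t hs ht
      rw [Set.image_union]
      exact hs.union ht
    · intro x hx
      obtain ⟨V, hV, hb⟩ := hf x hx.1
      exact ⟨V, nhdsWithin_mono _ (fun y hy => hy.1) hV, hb⟩
  obtain ⟨B, hB⟩ := this.exists_norm_le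
  exact ⟨B, fun x hx => hB _ ⟨x, hx, rfl⟩⟩

section
variable {f : ℝ → ℝ} {β : ℝ}

theorem RegularlyVarying.eventually_ne_zero (hf : RegularlyVarying f β) :
    ∀ᶠ t in atTop, f t ≠ 0 := by
  have h := hf.2 1 one_pos
  simp only [one_mul, Real.one_rpow] at h
  filter_upwards [h.eventually_ne one_ne_zero] with t ht h0
  simp [h0] at ht

/-- The exponential rescaling of a regularly varying function has a measurable version. -/
theorem RegularlyVarying.exists_aemeasurable (hf : RegularlyVarying f β) :
    ∃ g : ℝ → ℝ, AEMeasurable (fun x => g (Real.exp x)) ∧ ∀ᶠ t in atTop, g t = f t := by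
  obtain ⟨⟨A, hA⟩, -⟩ := hf
  refine ⟨(Set.Ioi A).indicator f,
    aemeasurable_comp_exp ((aemeasurable_indicator_iff measurableSet_Ioi).2 hA), ?_⟩
  filter_upwards [eventually_gt_atTop A] with t ht
  exact Set.indicator_of_mem ht f

theorem RegularlyVarying.tendsto_exp (hf : RegularlyVarying f β) (u : ℝ) :
    Tendsto (fun x => f (Real.exp (x + u)) / f (Real.exp x)) atTop (𝓝 (Real.exp (β * u))) := by
  have h := (hf.2 (Real.exp u) (Real.exp_pos u)).comp Real.tendsto_exp_atTop
  rw [← Real.exp_mul, mul_comm] at h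
  refine h.congr fun x => ?_
  simp only [Function.comp]
  rw [← Real.exp_add, add_comm u x]

theorem RegularlyVarying.congr {g : ℝ → ℝ} (hf : RegularlyVarying f β)
    (hg : ∀ᶠ t in atTop, g t = f t) :
    ∀ u, Tendsto (fun x => g (Real.exp (x + u)) / g (Real.exp x)) atTop
      (𝓝 (Real.exp (β * u))) := by
  intro u
  refine (hf.tendsto_exp u).congr' ?_
  have h1 := Real.tendsto_exp_atTop.eventually hg
  have h2 : Tendsto (fun x => x + u) atTop atTop := tendsto_atTop_add_const_right _ _ tendsto_id
  filter_upwards [h1, h2.eventually h1] with x hx hx'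
  rw [hx, hx']

/-- The logarithmic form of Potter's bounds. -/
theorem RegularlyVarying.log_potter (hf : RegularlyVarying f β) {ε : ℝ} (hε : 0 < ε) :
    ∃ X, ∀ x ≥ X, ∀ u ≥ 0, 0 < f (Real.exp (x + u)) / f (Real.exp x) ∧
      |Real.log (f (Real.exp (x + u)) / f (Real.exp x)) - β * u| ≤ ε * (u + 1) := by
  obtain ⟨g, hgm, hg⟩ := hf.exists_aemeasurable
  have hlim := hf.congr hg
  have hne : ∀ᶠ x in atTop, g (Real.exp x) ≠ 0 := by
    filter_upwards [Real.tendsto_exp_atTop.eventually hg,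
      Real.tendsto_exp_atTop.eventually hf.eventually_ne_zero] with x h1 h2
    rwa [h1]
  have htr : ∀ u : ℝ, Tendsto (fun x => x + u) atTop atTop := fun u =>
    tendsto_atTop_add_const_right _ _ tendsto_id
  set k : ℝ → ℝ := fun x => Real.log |g (Real.exp x)| - β * x with hk
  -- The function may be negative. Its positivity indicator is also slowly varying and takes only
  -- the values 0 and 1, so it is eventually constant; this makes the ratios positive, while k
  -- controls their size.
  set s : ℝ → ℝ := fun x => if 0 < g (Real.exp x) then 1 else 0 with hs
  have hkm : AEMeasurable k := by
    have h1 : AEMeasurable fun x => |g (Real.exp x)| := continuous_abs.measurable.comp_aemeasurable hgm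
    exact (Real.measurable_log.comp_aemeasurable h1).sub (by fun_prop)
  have hsm : AEMeasurable s := by
    have : Measurable fun y : ℝ => if 0 < y then (1 : ℝ) else 0 :=
      Measurable.ite measurableSet_Ioi measurable_const measurable_const
    exact this.comp_aemeasurable hgm
  have hkl : ∀ u, Tendsto (fun x => k (x + u) - k x) atTop (𝓝 0) := by
    intro u
    have h1 := ((hlim u).log (Real.exp_pos _).ne').sub_const (β * u)
    rw [Real.log_exp, sub_self] at h1
    refine h1.congr' ?_
    filter_upwards [hne, (htr u).eventually hne] with x hx hx'
    simp only [hk, Real.log_abs]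
    rw [Real.log_div hx' hx]
    ring
  have hsl : ∀ u, Tendsto (fun x => s (x + u) - s x) atTop (𝓝 0) := by
    intro u
    have h1 := (hlim u).eventually (lt_mem_nhds (Real.exp_pos _))
    refine tendsto_const_nhds.congr' ?_
    filter_upwards [h1] with x hx
    have : 0 < g (Real.exp (x + u)) ↔ 0 < g (Real.exp x) := by
      rcases div_pos_iff.1 hx with h | h
      · simp [h.1, h.2]
      · simp [h.1.not_gt, h.2.not_gt]
    simp only [hs, this, sub_self]
  obtain ⟨X1, hX1⟩ := uniform_of_slowlyVarying hkm hkl hε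
  obtain ⟨X2, hX2⟩ := uniform_of_slowlyVarying hsm hsl (show (0 : ℝ) < 1 / 2 by norm_num)
  obtain ⟨X3, hX3⟩ := eventually_atTop.1 hne
  obtain ⟨X4, hX4⟩ := eventually_atTop.1 (Real.tendsto_exp_atTop.eventually hg)
  have hs1 : ∀ x ≥ X2, ∀ u ∈ Set.Icc (0 : ℝ) 1, |s (x + u) - s x| ≤ 0 := by
    intro x hx u hu
    have := hX2 x hx u hu
    simp only [hs] at this ⊢
    split_ifs at this ⊢ <;> norm_num at this <;> norm_num
  refine ⟨max (max X1 X2) (max X3 X4), fun x hx u hu => ?_⟩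
  simp only [ge_iff_le, max_le_iff] at hx
  have hpk := potter_of_uniform hX1 hx.1.1 hu
  have hps := potter_of_uniform hs1 hx.1.2 hu
  have e0 := hX4 x hx.2.2
  have e1 := hX4 (x + u) (by linarith [hx.2.2])
  have n0 := hX3 x hx.2.1
  have n1 := hX3 (x + u) (by linarith [hx.2.1])
  rw [← e0, ← e1]
  constructor
  · simp only [hs] at hps
    split_ifs at hps with h1 h2 h2
    · exact div_pos h1 h2
    · norm_num at hps
    · norm_num at hps
    · exact div_pos_of_neg_of_neg (lt_of_le_of_ne (not_lt.1 h1) n1) (lt_of_le_of_ne (not_lt.1 h2) n0)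
  · rw [Real.log_div n1 n0]
    convert hpk using 2
    simp only [hk, Real.log_abs]
    ring

/-- Converts the logarithmic Potter error δ(u + 1) into an absolute error uniform in u, with c =
exp(-u). Since δ ≤ β/2, half of the decay exp(-βu) absorbs exp(δu), and the other half keeps u + 1
bounded by 1 + 2/β. -/
theorem exp_perturbation_le {β : ℝ} (hβ : 0 < β) {ε : ℝ} (hε : 0 < ε) :
    ∃ δ > 0, δ ≤ β / 2 ∧ δ ≤ 1 ∧ ∀ u ≥ 0, ∀ d : ℝ, |d| ≤ δ * (u + 1) →
      Real.exp (-(β * u)) * |Real.exp d - 1| ≤ ε := by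
  have hC : 0 < Real.exp 1 * (1 + 2 / β) := by positivity
  refine ⟨min (min (β / 2) 1) (ε / (Real.exp 1 * (1 + 2 / β))), by positivity,
    (min_le_left _ _).trans (min_le_left _ _), (min_le_left _ _).trans (min_le_right _ _), ?_⟩
  set δ := min (min (β / 2) 1) (ε / (Real.exp 1 * (1 + 2 / β))) with hδ
  have h1 : δ ≤ β / 2 := (min_le_left _ _).trans (min_le_left _ _)
  have h2 : δ ≤ 1 := (min_le_left _ _).trans (min_le_right _ _)
  have h3 : δ * (Real.exp 1 * (1 + 2 / β)) ≤ ε := (le_div_iff₀ hC).1 (min_le_right _ _)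
  have h0 : 0 ≤ δ := by positivity
  intro u hu d hd
  have e1 : |Real.exp d - 1| ≤ |d| * Real.exp |d| := by
    have ha := Real.add_one_le_exp d
    have hb := Real.add_one_le_exp (-d)
    have hc : Real.exp d - 1 ≤ d * Real.exp d := by
      have := mul_le_mul_of_nonneg_right hb (Real.exp_pos d).le
      rw [← Real.exp_add] at this
      simp at this
      linarith
    rw [abs_le]
    rcases abs_cases d with ⟨h, h'⟩ | ⟨h, h'⟩
    · rw [h]
      have : 0 ≤ d * Real.exp d := by positivity
      exact ⟨by linarith, hc⟩
    · rw [h]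
      have h4 : Real.exp d ≤ 1 := Real.exp_le_one_iff.2 h'.le
      have h5 : 1 ≤ Real.exp (-d) := Real.one_le_exp (by linarith)
      have h6 : -d ≤ -d * Real.exp (-d) := le_mul_of_one_le_right (by linarith) h5
      exact ⟨by linarith, by linarith⟩
  have e2 : Real.exp |d| ≤ Real.exp 1 * Real.exp (β / 2 * u) := by
    rw [← Real.exp_add]
    refine Real.exp_le_exp.2 (hd.trans ?_)
    have := mul_le_mul_of_nonneg_right h1 hu
    linarith
  have e3 : Real.exp (-(β * u)) * Real.exp (β / 2 * u) * (u + 1) ≤ 1 + 2 / β := by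
    rw [← Real.exp_add, show -(β * u) + β / 2 * u = -(β / 2 * u) by ring, Real.exp_neg,
      inv_mul_le_iff₀ (Real.exp_pos _)]
    have := Real.add_one_le_exp (β / 2 * u)
    have h7 : (β / 2 * u + 1) * (1 + 2 / β) ≤ Real.exp (β / 2 * u) * (1 + 2 / β) :=
      mul_le_mul_of_nonneg_right this (by positivity)
    have h8 : (β / 2 * u + 1) * (1 + 2 / β) = β / 2 * u + 1 + u + 2 / β := by
      field_simp
      ring
    have : 0 ≤ β / 2 * u := by positivity
    have : 0 ≤ 2 / β := by positivity
    linarith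
  calc Real.exp (-(β * u)) * |Real.exp d - 1|
      ≤ Real.exp (-(β * u)) * (δ * (u + 1) * (Real.exp 1 * Real.exp (β / 2 * u))) := by
        gcongr
        exact e1.trans (mul_le_mul hd e2 (Real.exp_pos _).le (by positivity))
    _ = δ * Real.exp 1 * (Real.exp (-(β * u)) * Real.exp (β / 2 * u) * (u + 1)) := by ring
    _ ≤ δ * Real.exp 1 * (1 + 2 / β) := by gcongr
    _ ≤ ε := by linarith

/-- Regularly varying functions of positive index vary regularly uniformly on `(0, 1]`. -/
theorem RegularlyVarying.uniform (hf : RegularlyVarying f β) (hβ : 0 < β)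
    (hfb : LocallyBounded f) {ε : ℝ} (hε : 0 < ε) :
    ∀ᶠ t in atTop, ∀ c ∈ Set.Ioc (0 : ℝ) 1, |f (c * t) / f t - c ^ β| ≤ ε := by
  obtain ⟨δ, hδ, hδβ, hδ1, hpert⟩ := exp_perturbation_le hβ hε
  obtain ⟨X, hX⟩ := hf.log_potter hδ
  obtain ⟨B, hB⟩ := hfb.exists_bound (Real.exp X)
  have hfX : f (Real.exp X) ≠ 0 := by
    intro h0
    have := (hX X le_rfl 0 le_rfl).1
    simp [h0] at this
  have hB0 : 0 ≤ B := (abs_nonneg _).trans (hB (Real.exp X) ⟨(Real.exp_pos X).le, le_rfl⟩)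
  -- Potter with δ ≤ β/2 forces |f| to grow at least like t^(β/2).
  have hinf : Tendsto (fun t => |f t|) atTop atTop := by
    have hlow : Tendsto (fun t => |f (Real.exp X)| *
        Real.exp (β / 2 * (Real.log t - X) - 1)) atTop atTop := by
      refine Tendsto.const_mul_atTop (abs_pos.2 hfX) (Real.tendsto_exp_atTop.comp ?_)
      refine tendsto_atTop_add_const_right _ _ (Tendsto.const_mul_atTop (by positivity) ?_)
      exact tendsto_atTop_add_const_right _ _ Real.tendsto_log_atTop
    refine tendsto_atTop_mono' _ ?_ hlow
    filter_upwards [eventually_ge_atTop (Real.exp X)] with t ht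
    have ht0 : 0 < t := (Real.exp_pos X).trans_le ht
    have hu : 0 ≤ Real.log t - X := sub_nonneg.2 ((Real.le_log_iff_exp_le ht0).2 ht)
    obtain ⟨h1, h2⟩ := hX X le_rfl _ hu
    rw [add_sub_cancel, Real.exp_log ht0] at h1 h2
    have h3 := (abs_le.1 h2).1
    have h4 : |f t| = |f (Real.exp X)| * (f t / f (Real.exp X)) := by
      rw [← abs_of_pos h1, abs_div]
      field_simp
    rw [h4]
    gcongr
    rw [← Real.le_log_iff_exp_le h1]
    have := mul_le_mul_of_nonneg_right hδβ hu
    linarith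
  have hpow : Tendsto (fun t : ℝ => (Real.exp X / t) ^ β) atTop (𝓝 0) := by
    have h1 : Tendsto (fun t : ℝ => Real.exp X / t) atTop (𝓝 0) :=
      tendsto_const_nhds.div_atTop tendsto_id
    have := h1.rpow_const (p := β) (Or.inr hβ.le)
    rwa [Real.zero_rpow hβ.ne'] at this
  filter_upwards [hinf.eventually_ge_atTop (2 * (B + 1) / ε),
    hpow.eventually (gt_mem_nhds (half_pos hε)), eventually_gt_atTop 0] with t h1 h2 ht c hc
  have hct : 0 < c * t := mul_pos hc.1 ht
  -- Above the threshold exp X, Potter applies between ct and t. Below it, f(ct) is bounded by local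
  -- boundedness while |f t| is large, and c^β < (exp X / t)^β is small as well.
  rcases le_or_gt (Real.exp X) (c * t) with hX1 | hX1
  · have hu : 0 ≤ -Real.log c := by
      have := Real.log_nonpos hc.1.le hc.2
      linarith
    obtain ⟨h3, h4⟩ := hX (Real.log (c * t)) ((Real.le_log_iff_exp_le hct).2 hX1) _ hu
    have e1 : Real.log (c * t) + -Real.log c = Real.log t := by
      rw [Real.log_mul hc.1.ne' ht.ne']
      ring
    rw [e1, Real.exp_log ht, Real.exp_log hct] at h3 h4
    have h5 := hpert _ hu (β * -Real.log c - Real.log (f t / f (c * t)))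
      (by rw [abs_sub_comm]; exact h4)
    have e2 : c ^ β = Real.exp (-(β * -Real.log c)) := by
      rw [Real.rpow_def_of_pos hc.1]
      congr 1
      ring
    have e3 : f (c * t) / f t = Real.exp (-(β * -Real.log c)) *
        Real.exp (β * -Real.log c - Real.log (f t / f (c * t))) := by
      rw [← Real.exp_add, neg_add_eq_sub, sub_sub_cancel_left, Real.exp_neg, Real.exp_log h3,
        inv_div]
    rw [e3, e2, ← mul_sub_one, abs_mul, abs_of_pos (Real.exp_pos _)]
    exact h5
  · have hBt := hB (c * t) ⟨hct.le, hX1.le⟩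
    have hft : 0 < |f t| := lt_of_lt_of_le (by positivity) h1
    have h3 : |f (c * t) / f t| ≤ ε / 2 := by
      rw [abs_div, div_le_iff₀ hft]
      rw [div_le_iff₀ hε] at h1
      linarith
    have h4 : c ^ β ≤ (Real.exp X / t) ^ β := by
      refine Real.rpow_le_rpow hc.1.le ?_ hβ.le
      rw [le_div_iff₀ ht]
      exact hX1.le
    have h5 : 0 ≤ c ^ β := Real.rpow_nonneg hc.1.le _
    rw [abs_le] at h3 ⊢
    constructor <;> linarith

end

/-! ### Down-closed sets: equidistribution modulo Q and densities of multiples. -/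

/-- A finite set of points with positive coordinates, closed under decreasing coordinates. -/
structure IsDown {r : ℕ} (R : Finset (Fin r → ℕ)) : Prop where
  pos : ∀ i ∈ R, ∀ k, 1 ≤ i k
  down : ∀ i ∈ R, ∀ j ≤ i, (∀ k, 1 ≤ j k) → j ∈ R

section
variable {r : ℕ} {R : Finset (Fin r → ℕ)}

theorem IsDown.sum_shift (hR : IsDown R) (g : (Fin r → ℕ) → ℝ) (b : Fin r → ℕ) :
    ∑ i ∈ R, (if i + b ∈ R then g (i + b) else 0) =
      ∑ i ∈ R, (if ∀ k, b k < i k then g i else 0) := by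
  rw [← Finset.sum_filter, ← Finset.sum_filter]
  refine Finset.sum_nbij' (fun i => i + b) (fun i => i - b) ?_ ?_ ?_ ?_ ?_
  · intro i hi
    rw [Finset.mem_filter] at hi ⊢
    refine ⟨hi.2, fun k => ?_⟩
    have := hR.pos i hi.1 k
    simp only [Pi.add_apply]
    omega
  · intro i hi
    rw [Finset.mem_filter] at hi ⊢
    have h1 : i - b + b = i := by
      funext k
      have := hi.2 k
      simp only [Pi.add_apply, Pi.sub_apply]
      omega
    rw [h1]
    refine ⟨hR.down i hi.1 _ (fun k => ?_) (fun k => ?_), hi.1⟩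
    · simp only [Pi.sub_apply]
      omega
    · have := hi.2 k
      simp only [Pi.sub_apply]
      omega
  · intro i _
    funext k
    simp
  · intro i hi
    rw [Finset.mem_filter] at hi
    funext k
    have := hi.2 k
    simp only [Pi.add_apply, Pi.sub_apply]
    omega
  · intro i _
    rfl

/-- Decreasing weights on a down-closed set are equidistributed modulo `Q`, up to the weight of the
points having a coordinate `≤ Q`. -/
theorem IsDown.equidistribution (hR : IsDown R) {Q : ℕ} [NeZero Q] {v : (Fin r → ℕ) → ℝ}
    (hv0 : ∀ i ∈ R, 0 ≤ v i) (hv : ∀ i ∈ R, ∀ j ∈ R, i ≤ j → v j ≤ v i)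
    {Φ : (Fin r → ZMod Q) → ℝ} (hΦ0 : ∀ z, 0 ≤ Φ z) (hΦ1 : ∀ z, Φ z ≤ 1) :
    |∑ i ∈ R, v i * Φ (fun k => (i k : ZMod Q)) -
        ((∑ z, Φ z) / (Q : ℝ) ^ r) * ∑ i ∈ R, v i| ≤
      ∑ i ∈ R with ∃ k, i k ≤ Q, v i := by
  set T := ∑ i ∈ R with ∃ k, i k ≤ Q, v i with hT
  set F : (Fin r → ℕ) → ℝ := fun i => Φ fun k => (i k : ZMod Q) with hF
  -- Translating by b loses exactly the points with some coordinate at most b k < Q; their weight is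
  -- at most T.
  have step : ∀ G : (Fin r → ℕ) → ℝ, (∀ i, 0 ≤ G i) → (∀ i, G i ≤ 1) → ∀ b : Fin r → ℕ,
      (∀ k, b k < Q) →
      0 ≤ ∑ i ∈ R, v i * G i - ∑ i ∈ R, (if i + b ∈ R then v (i + b) * G (i + b) else 0) ∧
      ∑ i ∈ R, v i * G i - ∑ i ∈ R, (if i + b ∈ R then v (i + b) * G (i + b) else 0) ≤ T := by
    intro G hG0 hG1 b hb
    rw [hR.sum_shift (fun i => v i * G i) b, ← Finset.sum_sub_distrib, hT, Finset.sum_filter]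
    constructor
    · refine Finset.sum_nonneg fun i hi => ?_
      have := mul_nonneg (hv0 i hi) (hG0 i)
      split_ifs <;> simp [this]
    · refine Finset.sum_le_sum fun i hi => ?_
      have := mul_le_of_le_one_right (hv0 i hi) (hG1 i)
      have h0 := hv0 i hi
      split_ifs with h1 h2 h2
      · simpa using h0
      · simp
      · simpa using this
      · refine absurd (fun k => ?_) h1
        push Not at h2
        exact (hb k).trans (h2 k)
  have key : ∀ z : Fin r → ZMod Q,
      |∑ i ∈ R, v i * Φ ((fun k => (i k : ZMod Q)) + z) - ∑ i ∈ R, v i * F i| ≤ T := by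
    intro z
    set b : Fin r → ℕ := fun k => (z k).val with hb
    have hFb : ∀ i : Fin r → ℕ, Φ ((fun k => (i k : ZMod Q)) + z) = F (i + b) := by
      intro i
      simp only [hF]
      congr 1
      funext k
      simp [hb]
    have hbQ : ∀ k, b k < Q := fun k => ZMod.val_lt _
    obtain ⟨a1, a2⟩ := step F (fun i => hΦ0 _) (fun i => hΦ1 _) b hbQ
    obtain ⟨b1, b2⟩ := step (fun _ => 1) (fun _ => zero_le_one) (fun _ => le_rfl) b hbQ
    simp only [mul_one] at b1 b2
    rw [← Finset.sum_sub_distrib] at b1 b2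
    -- The sums of v(i)F(i + b) and v(i)F(i) each exceed the translated sum by an amount in [0, T],
    -- hence differ by at most T. For the first this uses that v decreases, so v(i) - v(i + b) ≥ 0
    -- and F ≤ 1 can be replaced by 1.
    have c : ∑ i ∈ R, v i * F (i + b) -
        ∑ i ∈ R, (if i + b ∈ R then v (i + b) * F (i + b) else 0) =
        ∑ i ∈ R, (v i - if i + b ∈ R then v (i + b) else 0) * F (i + b) := by
      rw [← Finset.sum_sub_distrib]
      refine Finset.sum_congr rfl fun i _ => ?_
      split_ifs <;> ring
    have hd : ∀ i ∈ R, 0 ≤ v i - if i + b ∈ R then v (i + b) else 0 := by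
      intro i hi
      split_ifs with h
      · have := hv i hi _ h (fun k => by simp)
        linarith
      · simpa using hv0 i hi
    have c1 : 0 ≤ ∑ i ∈ R, (v i - if i + b ∈ R then v (i + b) else 0) * F (i + b) :=
      Finset.sum_nonneg fun i hi => mul_nonneg (hd i hi) (hΦ0 _)
    have c2 : ∑ i ∈ R, (v i - if i + b ∈ R then v (i + b) else 0) * F (i + b) ≤
        ∑ i ∈ R, (v i - if i + b ∈ R then v (i + b) else 0) :=
      Finset.sum_le_sum fun i hi => mul_le_of_le_one_right (hd i hi) (hΦ1 _)
    simp only [hFb]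
    rw [abs_le]
    constructor <;> linarith
  -- Over a complete set of shifts z, the values of Φ at i + z run through all residues, so each i
  -- contributes the same total.
  have hsum : ∑ z : Fin r → ZMod Q, ∑ i ∈ R, v i * Φ ((fun k => (i k : ZMod Q)) + z) =
      (∑ z, Φ z) * ∑ i ∈ R, v i := by
    rw [Finset.sum_comm, Finset.mul_sum]
    refine Finset.sum_congr rfl fun i _ => ?_
    rw [← Finset.mul_sum, mul_comm]
    congr 1
    exact Equiv.sum_comp (Equiv.addLeft fun k => (i k : ZMod Q)) Φ
  have hcard : ((Finset.univ : Finset (Fin r → ZMod Q)).card : ℝ) = (Q : ℝ) ^ r := by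
    simp [ZMod.card]
  have hQ : (0 : ℝ) < (Q : ℝ) ^ r := by
    have : 0 < Q := Nat.pos_of_ne_zero (NeZero.ne Q)
    positivity
  have hfin : |(∑ z, Φ z) * ∑ i ∈ R, v i - (Q : ℝ) ^ r * ∑ i ∈ R, v i * F i| ≤
      (Q : ℝ) ^ r * T := by
    rw [← hsum, ← hcard, ← nsmul_eq_mul, ← Finset.sum_const, ← Finset.sum_sub_distrib]
    refine (Finset.abs_sum_le_sum_abs _ _).trans ?_
    rw [← nsmul_eq_mul, ← Finset.sum_const]
    exact Finset.sum_le_sum fun z _ => key z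
  rw [abs_sub_comm]
  have e : (∑ z, Φ z) / (Q : ℝ) ^ r * ∑ i ∈ R, v i - ∑ i ∈ R, v i * F i =
      ((∑ z, Φ z) * ∑ i ∈ R, v i - (Q : ℝ) ^ r * ∑ i ∈ R, v i * F i) / (Q : ℝ) ^ r := by
    field_simp
  rw [e, abs_div, abs_of_pos hQ, div_le_iff₀ hQ, mul_comm T]
  exact hfin

/-- The points of a down-closed set divisible by `d` have density at most `1 / ∏ d`. -/
theorem IsDown.card_dvd_mul_le (hR : IsDown R) (d : Fin r → ℕ) :
    (R.filter fun i => ∀ k, d k ∣ i k).card * ∏ k, d k ≤ R.card := by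
  have h1 : ∏ k, d k = (Fintype.piFinset fun k => Finset.range (d k)).card := by
    simp [Fintype.card_piFinset]
  rw [h1, ← Finset.card_product]
  -- The boxes i - c with 0 ≤ c k < d k, below distinct multiples i of d, are disjoint and stay
  -- inside R.
  refine Finset.card_le_card_of_injOn (fun x => x.1 - x.2) ?_ ?_
  · rintro ⟨i, c⟩ hx
    simp only [Finset.coe_product, Set.mem_prod, Finset.mem_coe, Finset.mem_filter,
      Fintype.mem_piFinset, Finset.mem_range] at hx
    refine hR.down i hx.1.1 _ (fun k => ?_) (fun k => ?_)
    · simp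
    · have := Nat.le_of_dvd (hR.pos i hx.1.1 k) (hx.1.2 k)
      have := hx.2 k
      simp only [Pi.sub_apply]
      omega
  · rintro ⟨i, c⟩ hx ⟨i', c'⟩ hx' h
    simp only [Finset.coe_product, Set.mem_prod, Finset.mem_coe, Finset.mem_filter,
      Fintype.mem_piFinset, Finset.mem_range] at hx hx'
    have key : ∀ k, i k = i' k ∧ c k = c' k := by
      intro k
      have hk := congrFun h k
      simp only [Pi.sub_apply] at hk
      obtain ⟨a, ha⟩ := hx.1.2 k
      obtain ⟨a', ha'⟩ := hx'.1.2 k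
      have h1 := Nat.le_of_dvd (hR.pos i hx.1.1 k) (hx.1.2 k)
      have h2 := Nat.le_of_dvd (hR.pos i' hx'.1.1 k) (hx'.1.2 k)
      have h3 := hx.2 k
      have h4 := hx'.2 k
      have h5 : a = a' := by
        rw [ha] at h1 hk
        rw [ha'] at h2 hk
        by_contra hne
        rcases Nat.lt_or_gt_of_ne hne with hlt | hlt
        · have := Nat.mul_le_mul_left (d k) (Nat.succ_le_of_lt hlt)
          rw [Nat.mul_succ] at this
          omega
        · have := Nat.mul_le_mul_left (d k) (Nat.succ_le_of_lt hlt)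
          rw [Nat.mul_succ] at this
          omega
      subst h5
      refine ⟨ha.trans ha'.symm, ?_⟩
      omega
    exact Prod.ext (funext fun k => (key k).1) (funext fun k => (key k).2)

end

/-! ### The discrete region: monotonicity and the bound on the product. -/

section
variable {r : ℕ}

theorem symmP_mono {l : ℕ} {i j : Fin r → ℕ} (h : i ≤ j) : symmP l i ≤ symmP l j := by
  simp only [symmP_eq_sum]
  exact Finset.sum_le_sum fun s _ => Finset.prod_le_prod' fun k _ => h k

theorem isDown_region {l : ℕ} (hl : 1 ≤ l) (hlr : l ≤ r) (n : ℕ) : IsDown (region l r n) where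
  pos i hi := ((mem_region hl hlr i).1 hi).1
  down i hi j hj hj1 := (mem_region hl hlr j).2
    ⟨hj1, (symmP_mono hj).trans ((mem_region hl hlr i).1 hi).2⟩

/-- If all sums over `l`-subsets are nonpositive, so is the total sum. -/
theorem sum_nonpos_of_powersetCard {ι : Type*} [DecidableEq ι] {u : ι → ℝ} {l : ℕ} (hl : 1 ≤ l)
    (A : Finset ι) (hA : l ≤ A.card) (h : ∀ s ⊆ A, s.card = l → ∑ j ∈ s, u j ≤ 0) :
    ∑ j ∈ A, u j ≤ 0 := by
  have key : ∀ m, l ≤ m → ∀ s ⊆ A, s.card = m → ∑ j ∈ s, u j ≤ 0 := by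
    intro m hm
    induction m, hm using Nat.le_induction with
    | base => exact h
    | succ m hm ih =>
      intro s hs hcard
      -- Removing any a leaves a nonpositive sum, so the total S satisfies S ≤ u a. Summing over a
      -- gives (m + 1)S ≤ S, and m ≥ 1 forces S ≤ 0.
      have h1 : ∀ a ∈ s, ∑ j ∈ s, u j ≤ u a := by
        intro a ha
        rw [← Finset.add_sum_erase s u ha]
        have := ih (s.erase a) ((Finset.erase_subset a s).trans hs)
          (by rw [Finset.card_erase_of_mem ha, hcard]; rfl)
        linarith
      have h2 := Finset.sum_le_sum h1
      rw [Finset.sum_const, hcard, nsmul_eq_mul] at h2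
      push_cast at h2
      have hm1 : (1 : ℝ) ≤ m := by exact_mod_cast hl.trans hm
      by_contra! hpos
      nlinarith
  exact key A.card hA A subset_rfl rfl

theorem prod_le_symmP_real {l : ℕ} {y : Fin r → ℝ} (hy : ∀ k, 0 ≤ y k) {s : Finset (Fin r)}
    (hs : s.card = l) : ∏ k ∈ s, y k ≤ symmP l y := by
  rw [symmP_eq_sum]
  exact Finset.single_le_sum (f := fun s : Finset (Fin r) => ∏ k ∈ s, y k)
    (fun t _ => Finset.prod_nonneg fun k _ => hy k) (by simp [Finset.mem_powersetCard, hs])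

theorem symmP_natCast {l : ℕ} (i : Fin r → ℕ) :
    symmP l (fun k => (i k : ℝ)) = (symmP l i : ℕ) := by
  simp [symmP_eq_sum]

/-- On the hyperbolic region, the product of the coordinates is at most `n ^ (r / l)`. -/
theorem prod_le_rpow {l n : ℕ} (hl : 1 ≤ l) (hlr : l ≤ r) {i : Fin r → ℕ}
    (hi : i ∈ region l r n) : ((∏ k, i k : ℕ) : ℝ) ≤ (n : ℝ) ^ ((r : ℝ) / (l : ℝ)) := by
  obtain ⟨hi1, hi2⟩ := (mem_region hl hlr i).1 hi
  have hpos : ∀ k, (0 : ℝ) < i k := fun k => by exact_mod_cast hi1 k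
  have hl0 : (0 : ℝ) < l := by exact_mod_cast hl
  have hbound : ∀ s : Finset (Fin r), s.card = l → ∏ k ∈ s, (i k : ℝ) ≤ n := by
    intro s hs
    have := prod_le_symmP_real (fun k => (hpos k).le) hs
    rw [symmP_natCast] at this
    exact this.trans (by exact_mod_cast hi2)
  have hn : (0 : ℝ) < n := by
    obtain ⟨s, -, hs⟩ := Finset.exists_subset_card_eq (s := (Finset.univ : Finset (Fin r))) (n := l)
      (by simpa using hlr)
    exact (Finset.prod_pos fun k _ => hpos k).trans_le (hbound s hs)
  -- Centring by (log n)/l turns "every product of l coordinates is at most n" into nonpositive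
  -- l-sums.
  have hsum := sum_nonpos_of_powersetCard (u := fun k => Real.log (i k) - Real.log n / l) hl
    (Finset.univ : Finset (Fin r)) (by simpa using hlr) (by
      intro s _ hs
      rw [Finset.sum_sub_distrib, Finset.sum_const, hs, nsmul_eq_mul,
        mul_div_cancel₀ _ hl0.ne', sub_nonpos, ← Real.log_prod fun k _ => (hpos k).ne']
      exact Real.log_le_log (Finset.prod_pos fun k _ => hpos k) (hbound s hs))
  rw [Finset.sum_sub_distrib, ← Real.log_prod fun k _ => (hpos k).ne'] at hsum
  simp only [Finset.sum_const, Finset.card_univ, Fintype.card_fin, nsmul_eq_mul] at hsum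
  push_cast
  rw [← Real.log_le_log_iff (Finset.prod_pos fun k _ => hpos k) (Real.rpow_pos_of_pos hn _),
    Real.log_rpow hn]
  have : (r : ℝ) / l * Real.log n = r * (Real.log n / l) := by ring
  linarith

theorem ones_mem_region {l n : ℕ} (hl : 1 ≤ l) (hlr : l ≤ r) (hn : r.choose l ≤ n) :
    (fun _ => 1) ∈ region l r n := by
  rw [mem_region hl hlr]
  refine ⟨fun _ => le_rfl, ?_⟩
  simpa [symmP_eq_sum] using hn

theorem eventually_region_card_pos {l : ℕ} (hl : 1 ≤ l) (hlr : l ≤ r) :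
    ∀ᶠ n in atTop, 0 < ((region l r n).card : ℝ) := by
  filter_upwards [eventually_ge_atTop (r.choose l)] with n hn
  exact_mod_cast Finset.card_pos.2 ⟨_, ones_mem_region hl hlr hn⟩

end

/-! ### The continuous region: finite volume for l < r and null boundary. -/

section
variable {r l : ℕ}

theorem symmP_smul (s : ℝ) (y : Fin r → ℝ) : symmP l (s • y) = s ^ l * symmP l y := by
  simp only [symmP_eq_sum, Finset.mul_sum]
  refine Finset.sum_congr rfl fun t ht => ?_
  simp only [Pi.smul_apply, smul_eq_mul, Finset.prod_mul_distrib, Finset.prod_const,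
    (Finset.mem_powersetCard.1 ht).2]

theorem symmP_mono_real {y z : Fin r → ℝ} (hy : ∀ k, 0 ≤ y k) (h : ∀ k, y k ≤ z k) :
    symmP l y ≤ symmP l z := by
  simp only [symmP_eq_sum]
  exact Finset.sum_le_sum fun s _ => Finset.prod_le_prod (fun k _ => hy k) fun k _ => h k

theorem continuous_symmP : Continuous fun y : Fin r → ℝ => symmP l y := by
  simp only [symmP_eq_sum]
  fun_prop

theorem sum_log_nonpos {y : Fin r → ℝ} (hy : ∀ k, 0 < y k) (h : symmP l y ≤ 1) (hl : 1 ≤ l)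
    {A : Finset (Fin r)} (hA : l ≤ A.card) : ∑ k ∈ A, Real.log (y k) ≤ 0 := by
  refine sum_nonpos_of_powersetCard hl A hA fun s _ hs => ?_
  rw [← Real.log_prod fun k _ => (hy k).ne']
  exact Real.log_nonpos (Finset.prod_nonneg fun k _ => (hy k).le)
    ((prod_le_symmP_real (fun k => (hy k).le) hs).trans h)

theorem prod_le_one_of_mem_contRegion (hl : 1 ≤ l) (hlr : l ≤ r) {y : Fin r → ℝ}
    (h : y ∈ contRegion l r 1) : ∏ k, y k ≤ 1 := by
  by_cases h0 : ∃ k, y k = 0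
  · obtain ⟨k, hk⟩ := h0
    rw [Finset.prod_eq_zero (Finset.mem_univ k) hk]
    exact zero_le_one
  · push Not at h0
    have hpos : ∀ k, 0 < y k := fun k => lt_of_le_of_ne (h.1 k) (h0 k).symm
    have := sum_log_nonpos hpos h.2 hl (A := Finset.univ) (by simpa using hlr)
    rw [← Real.log_prod fun k _ => (hpos k).ne'] at this
    have hp : 0 < ∏ k, y k := Finset.prod_pos fun k _ => hpos k
    exact (Real.log_nonpos_iff hp.le).1 this

/-- The hypothesis says that any r - 1 of the numbers have nonpositive sum. With u k minimal, r u k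
≤ S ≤ u k gives u k ≤ 0, and |u j| ≤ u j - 2 u k then bounds the sum of absolute values by -2r u k.
The gain of 1/(2r) is what makes `halfLineWeight` integrable. -/
theorem sum_add_sum_abs_nonpos (hr : 2 ≤ r) {u : Fin r → ℝ} (h : ∀ k, ∑ j, u j ≤ u k) :
    ∑ k, u k + (1 / (2 * (r : ℝ))) * ∑ k, |u k| ≤ 0 := by
  have hr0 : (2 : ℝ) ≤ r := by exact_mod_cast hr
  have : NeZero r := ⟨by omega⟩
  obtain ⟨k, -, hk⟩ := Finset.exists_min_image (Finset.univ : Finset (Fin r)) u ⟨0, Finset.mem_univ _⟩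
  have hS := h k
  have h1 : (r : ℝ) * u k ≤ ∑ j, u j := by
    have := Finset.sum_le_sum hk
    simpa using this
  have h2 : u k ≤ 0 := by
    by_contra! hpos
    nlinarith
  have h3 : ∑ j, |u j| ≤ ∑ j, (u j - 2 * u k) := by
    refine Finset.sum_le_sum fun j hj => ?_
    have := hk j hj
    rw [abs_le]
    constructor <;> linarith
  rw [Finset.sum_sub_distrib] at h3
  simp only [Finset.sum_const, Finset.card_univ, Fintype.card_fin, nsmul_eq_mul] at h3
  have h4 : (1 / (2 * (r : ℝ))) * ∑ j, |u j| ≤ (1 / (2 * (r : ℝ))) * (-(2 * r * u k)) := by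
    gcongr
    linarith
  have h5 : (1 / (2 * (r : ℝ))) * (-(2 * r * u k)) = -u k := by
    field_simp
  linarith

/-- An integrable function on the half-line that dominates products over the region. -/
noncomputable def halfLineWeight (δ : ℝ) (y : ℝ) : ℝ :=
  (Set.Ioc 0 1).indicator (fun y => y ^ (δ - 1)) y + (Set.Ioi 1).indicator (fun y => y ^ (-1 - δ)) y

theorem integrable_halfLineWeight {δ : ℝ} (hδ : 0 < δ) : Integrable (halfLineWeight δ) := by
  refine Integrable.add ?_ ?_
  · rw [integrable_indicator_iff measurableSet_Ioc]
    exact (intervalIntegrable_iff_integrableOn_Ioc_of_le zero_le_one).1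
      (intervalIntegral.intervalIntegrable_rpow' (by linarith))
  · rw [integrable_indicator_iff measurableSet_Ioi]
    exact integrableOn_Ioi_rpow_of_lt (by linarith) one_pos

theorem halfLineWeight_of_pos {δ y : ℝ} (hy : 0 < y) :
    halfLineWeight δ y = Real.exp (-(Real.log y + δ * |Real.log y|)) := by
  rcases le_or_gt y 1 with h | h
  · rw [halfLineWeight, Set.indicator_of_mem (show y ∈ Set.Ioc 0 1 from ⟨hy, h⟩),
      Set.indicator_of_notMem (by simpa using h), add_zero, Real.rpow_def_of_pos hy,
      abs_of_nonpos (Real.log_nonpos hy.le h)]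
    congr 1
    ring
  · rw [halfLineWeight, Set.indicator_of_notMem (fun h' => h.not_ge h'.2),
      Set.indicator_of_mem (show y ∈ Set.Ioi 1 from h), zero_add, Real.rpow_def_of_pos hy, abs_of_pos (Real.log_pos h)]
    congr 1
    ring

theorem ae_ne_zero : ∀ᵐ y : Fin r → ℝ, ∀ k, y k ≠ 0 := by
  rw [ae_all_iff]
  intro k
  rw [ae_iff]
  simp only [not_not]
  exact Measure.pi_hyperplane (fun _ => (volume : Measure ℝ)) k 0

/-- As l ≤ r - 1, any r - 1 coordinates have product at most 1 on the region. By
`sum_add_sum_abs_nonpos` for the logarithms, the integrable product of weights is then at least 1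
there. -/
theorem volume_contRegion_lt_top (hr : 2 ≤ r) (hl : 1 ≤ l) (hlr : l < r) :
    volume (contRegion l r 1) < ⊤ := by
  have hr0 : (0 : ℝ) < r := by
    have : 0 < r := by omega
    exact_mod_cast this
  set δ : ℝ := 1 / (2 * (r : ℝ)) with hδ
  have hint : Integrable fun y : Fin r → ℝ => ∏ k, halfLineWeight δ (y k) :=
    Integrable.fintype_prod fun _ => integrable_halfLineWeight (by positivity)
  refine lt_of_le_of_lt (measure_mono_ae ?_) (hint.measure_norm_ge_lt_top one_pos)
  filter_upwards [ae_ne_zero (r := r)] with y hy0 hy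
  have hpos : ∀ k, 0 < y k := fun k => lt_of_le_of_ne (hy.1 k) (hy0 k).symm
  change 1 ≤ ‖∏ k, halfLineWeight δ (y k)‖
  simp only [halfLineWeight_of_pos (hpos _)]
  rw [← Real.exp_sum, Real.norm_of_nonneg (Real.exp_pos _).le]
  refine Real.one_le_exp ?_
  rw [Finset.sum_neg_distrib, Finset.sum_add_distrib, ← Finset.mul_sum]
  have := sum_add_sum_abs_nonpos hr (u := fun k => Real.log (y k)) (fun k => by
    have h1 := sum_log_nonpos hpos hy.2 hl (A := Finset.univ.erase k) (by
      rw [Finset.card_erase_of_mem (Finset.mem_univ k)]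
      simp
      omega)
    rw [← Finset.add_sum_erase Finset.univ _ (Finset.mem_univ k)]
    linarith)
  linarith

theorem volume_contRegion_pos (hl : 1 ≤ l) (hlr : l ≤ r) : 0 < volume (contRegion l r 1) := by
  have hC : 0 < r.choose l := Nat.choose_pos hlr
  have hC1 : (1 : ℝ) ≤ r.choose l := by exact_mod_cast hC
  have hsub : Set.Icc (fun _ => 0 : Fin r → ℝ) (fun _ => 1 / (r.choose l : ℝ)) ⊆
      contRegion l r 1 := by
    intro y hy
    refine ⟨hy.1, (symmP_mono_real hy.1 hy.2).trans ?_⟩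
    simp only [symmP_eq_sum]
    rw [Finset.sum_congr rfl (g := fun _ => (1 / (r.choose l : ℝ)) ^ l) (by
      intro s hs
      rw [Finset.prod_const, (Finset.mem_powersetCard.1 hs).2])]
    rw [Finset.sum_const, Finset.card_powersetCard, nsmul_eq_mul]
    simp only [Finset.card_univ, Fintype.card_fin]
    have h1 : (1 / (r.choose l : ℝ)) ^ l ≤ 1 / (r.choose l : ℝ) :=
      pow_le_of_le_one (by positivity) ((div_le_one (by positivity)).2 hC1) (by omega)
    calc (r.choose l : ℝ) * (1 / (r.choose l : ℝ)) ^ l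
        ≤ (r.choose l : ℝ) * (1 / (r.choose l : ℝ)) := by gcongr
      _ = 1 := by field_simp
  refine lt_of_lt_of_le ?_ (measure_mono hsub)
  rw [Real.volume_Icc_pi]
  rw [Finset.prod_const]
  refine ENNReal.pow_pos ?_ _
  rw [ENNReal.ofReal_pos, sub_zero]
  positivity

open scoped Pointwise in
theorem contRegion_smul_subset {s : ℝ} (hs : 0 < s) :
    s • contRegion l r 1 ⊆ {y | (∀ k, 0 ≤ y k) ∧ symmP l y ≤ s ^ l} := by
  rintro _ ⟨y, hy, rfl⟩
  refine ⟨fun k => mul_nonneg hs.le (hy.1 k), ?_⟩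
  simp only [symmP_smul]
  exact mul_le_of_le_one_right (by positivity) hy.2

open scoped Pointwise in
/-- The boundary of the continuous region is a null set. -/
theorem ae_symmP_ne_one (hr : 2 ≤ r) (hl : 1 ≤ l) (hlr : l < r) :
    ∀ᵐ y : Fin r → ℝ, (∀ k, 0 ≤ y k) → symmP l y ≠ 1 := by
  set A : Set (Fin r → ℝ) := {y | (∀ k, 0 ≤ y k) ∧ symmP l y = 1} with hA
  have hfin := volume_contRegion_lt_top hr hl hlr
  have hAD : A ⊆ contRegion l r 1 := fun y hy => ⟨hy.1, hy.2.le⟩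
  -- For s < 1 the dilate of the region by s misses the boundary A and lies in the region, so A has
  -- volume at most (1 - s^r) times that of the region; then s tends to 1.
  have key : ∀ s ∈ Set.Ioo (0 : ℝ) 1,
      volume.real A ≤ volume.real (contRegion l r 1) - s ^ r * volume.real (contRegion l r 1) := by
    intro s hs
    have hsub := contRegion_smul_subset (l := l) (r := r) hs.1
    have hsl : s ^ l < 1 := pow_lt_one₀ hs.1.le hs.2 (by omega)
    have hdisj : Disjoint A (s • contRegion l r 1) := by
      rw [Set.disjoint_left]
      intro y hy hy'
      have := (hsub hy').2
      rw [hy.2] at this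
      linarith
    have hsubD : s • contRegion l r 1 ⊆ contRegion l r 1 := fun y hy =>
      ⟨(hsub hy).1, (hsub hy).2.trans hsl.le⟩
    have hm : MeasurableSet (s • contRegion l r 1) :=
      (measurableSet_contRegion l r 1).const_smul₀ s
    have h1 : volume.real (A ∪ s • contRegion l r 1) ≤ volume.real (contRegion l r 1) :=
      measureReal_mono (Set.union_subset hAD hsubD) hfin.ne
    rw [measureReal_union hdisj hm (measure_ne_top_of_subset hAD hfin.ne)
      (measure_ne_top_of_subset hsubD hfin.ne)] at h1
    have h2 : volume.real (s • contRegion l r 1) = s ^ r * volume.real (contRegion l r 1) := by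
      simp only [Measure.real, Measure.addHaar_smul, Module.finrank_fin_fun, ENNReal.toReal_mul]
      rw [abs_of_pos (pow_pos hs.1 r), ENNReal.toReal_ofReal (pow_pos hs.1 r).le]
    linarith
  have hlim : Tendsto (fun s : ℝ => volume.real (contRegion l r 1) -
      s ^ r * volume.real (contRegion l r 1)) (𝓝[<] 1) (𝓝 0) := by
    have : Continuous fun s : ℝ => volume.real (contRegion l r 1) -
      s ^ r * volume.real (contRegion l r 1) := by fun_prop
    have h1 := this.tendsto 1
    simp only [one_pow, one_mul, sub_self] at h1
    exact h1.mono_left nhdsWithin_le_nhds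
  have h0 : volume.real A ≤ 0 := by
    refine ge_of_tendsto hlim ?_
    filter_upwards [Ioo_mem_nhdsLT (show (0 : ℝ) < 1 by norm_num)] with s hs
    exact key s hs
  have h00 : volume A = 0 := by
    have := le_antisymm h0 measureReal_nonneg
    exact (measureReal_eq_zero_iff (measure_ne_top_of_subset hAD hfin.ne)).1 this
  rw [ae_iff]
  convert h00 using 2
  ext y
  simp [hA]

end

/-! ### Lattice sums as integrals, for l < r. -/

section
variable {r l : ℕ}

/-- The upper corner of the half-open lattice cube of side `1 / N` containing `y`, times `N`. -/
noncomputable def upperCorner (N : ℝ) (y : Fin r → ℝ) : Fin r → ℕ := fun k => ⌊N * y k⌋₊ + 1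

/-- The half-open cube of side `1 / N` with upper corner `i / N`. -/
def latticeCube (N : ℝ) (i : Fin r → ℕ) : Set (Fin r → ℝ) :=
  Set.univ.pi fun k => Set.Ico (((i k : ℝ) - 1) / N) ((i k : ℝ) / N)

theorem mem_latticeCube {N : ℝ} (hN : 0 < N) {i : Fin r → ℕ} (hi : ∀ k, 1 ≤ i k)
    {y : Fin r → ℝ} : y ∈ latticeCube N i ↔ (∀ k, 0 ≤ y k) ∧ upperCorner N y = i := by
  simp only [latticeCube, Set.mem_univ_pi, Set.mem_Ico, div_le_iff₀ hN, lt_div_iff₀ hN,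
    upperCorner, funext_iff, ← forall_and]
  refine forall_congr' fun k => ?_
  have h1 : (1 : ℝ) ≤ i k := by exact_mod_cast hi k
  constructor
  · rintro ⟨ha, hb⟩
    have hy : 0 ≤ y k := by
      by_contra! h
      nlinarith
    refine ⟨hy, ?_⟩
    have : ⌊N * y k⌋₊ = i k - 1 := by
      rw [Nat.floor_eq_iff (mul_nonneg hN.le hy)]
      rw [Nat.cast_sub (hi k)]
      constructor <;> push_cast <;> linarith
    have := hi k
    omega
  · rintro ⟨hy, he⟩
    have ha := Nat.floor_le (mul_nonneg hN.le hy)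
    have hb := Nat.lt_floor_add_one (N * y k)
    rw [← he]
    push_cast
    constructor <;> linarith

theorem volume_real_latticeCube {N : ℝ} (hN : 0 < N) (i : Fin r → ℕ) :
    volume.real (latticeCube N i) = 1 / N ^ r := by
  rw [Measure.real, latticeCube, Real.volume_pi_Ico_toReal]
  · rw [Finset.prod_congr rfl (g := fun _ => 1 / N) (fun k _ => by ring)]
    simp
  · intro k
    simp only
    gcongr
    linarith

theorem integral_sum_latticeCube {N : ℝ} (hN : 0 < N) (R : Finset (Fin r → ℕ))
    (w : (Fin r → ℕ) → ℝ) :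
    ∫ y, ∑ i ∈ R, (latticeCube N i).indicator (fun _ => w i) y = (∑ i ∈ R, w i) / N ^ r := by
  have hm : ∀ i : Fin r → ℕ, MeasurableSet (latticeCube N i) := fun i =>
    MeasurableSet.univ_pi fun _ => measurableSet_Ico
  have hfin : ∀ i : Fin r → ℕ, volume (latticeCube N i) ≠ ⊤ := by
    intro i h
    have := volume_real_latticeCube hN i
    rw [Measure.real, h, ENNReal.toReal_top] at this
    have h2 : 0 < 1 / N ^ r := by positivity
    linarith
  rw [integral_finsetSum]
  · rw [Finset.sum_div]
    refine Finset.sum_congr rfl fun i _ => ?_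
    rw [integral_indicator_const _ (hm i), volume_real_latticeCube hN, smul_eq_mul]
    ring
  · intro i _
    rw [integrable_indicator_iff (hm i)]
    exact integrableOn_const (hfin i)

theorem measurable_sum_latticeCube {N : ℝ} (R : Finset (Fin r → ℕ)) (w : (Fin r → ℕ) → ℝ) :
    Measurable fun y => ∑ i ∈ R, (latticeCube N i).indicator (fun _ => w i) y :=
  Finset.measurable_sum _ fun _ _ => measurable_const.indicator
    (MeasurableSet.univ_pi fun _ => measurableSet_Ico)

theorem sum_latticeCube_of_mem {N : ℝ} (hN : 0 < N) {R : Finset (Fin r → ℕ)}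
    (hR : ∀ i ∈ R, ∀ k, 1 ≤ i k) (w : (Fin r → ℕ) → ℝ) {y : Fin r → ℝ}
    (hy : ∀ k, 0 ≤ y k) (h : upperCorner N y ∈ R) :
    ∑ i ∈ R, (latticeCube N i).indicator (fun _ => w i) y = w (upperCorner N y) := by
  rw [Finset.sum_eq_single (upperCorner N y)]
  · exact Set.indicator_of_mem ((mem_latticeCube hN (hR _ h)).2 ⟨hy, rfl⟩) _
  · intro i hi hne
    refine Set.indicator_of_notMem (fun hmem => ?_) _
    exact hne ((mem_latticeCube hN (hR _ hi)).1 hmem).2.symm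
  · exact fun h' => absurd h h'

theorem sum_latticeCube_of_notMem {N : ℝ} (hN : 0 < N) {R : Finset (Fin r → ℕ)}
    (hR : ∀ i ∈ R, ∀ k, 1 ≤ i k) (w : (Fin r → ℕ) → ℝ) {y : Fin r → ℝ}
    (h : ¬ ((∀ k, 0 ≤ y k) ∧ upperCorner N y ∈ R)) :
    ∑ i ∈ R, (latticeCube N i).indicator (fun _ => w i) y = 0 := by
  refine Finset.sum_eq_zero fun i hi => Set.indicator_of_notMem (fun hmem => h ?_) _
  obtain ⟨h1, h2⟩ := (mem_latticeCube hN (hR _ hi)).1 hmem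
  exact ⟨h1, h2 ▸ hi⟩

theorem tendsto_upperCorner_div {N : ℕ → ℝ} (hN : Tendsto N atTop atTop) {y : Fin r → ℝ}
    (hy : ∀ k, 0 ≤ y k) (k : Fin r) :
    Tendsto (fun n => (upperCorner (N n) y k : ℝ) / N n) atTop (𝓝 (y k)) := by
  have h1 : Tendsto (fun n => y k + 1 / N n) atTop (𝓝 (y k)) := by
    have := (tendsto_const_nhds (x := (1 : ℝ))).div_atTop hN
    simpa using this.const_add (y k)
  refine tendsto_of_tendsto_of_tendsto_of_le_of_le' tendsto_const_nhds h1 ?_ ?_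
  · filter_upwards [hN.eventually_gt_atTop 0] with n hn
    rw [le_div_iff₀ hn]
    have := (Nat.lt_floor_add_one (N n * y k)).le
    simp only [upperCorner]
    push_cast
    linarith
  · filter_upwards [hN.eventually_gt_atTop 0] with n hn
    rw [div_le_iff₀ hn, add_mul, one_div_mul_cancel hn.ne']
    have := Nat.floor_le (mul_nonneg hn.le (hy k))
    simp only [upperCorner]
    push_cast
    linarith

theorem symmP_natCast_div {N : ℝ} (i : Fin r → ℕ) :
    symmP l (fun k => (i k : ℝ) / N) = (symmP l i : ℕ) / N ^ l := by
  have : (fun k => (i k : ℝ) / N) = N⁻¹ • fun k => (i k : ℝ) := by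
    funext k
    simp [div_eq_inv_mul]
  rw [this, symmP_smul, symmP_natCast, inv_pow, div_eq_inv_mul]

theorem upperCorner_mem_region_iff {n : ℕ} (hl : 1 ≤ l) (hlr : l ≤ r) {N : ℝ} (hN : 0 < N)
    (hNn : N ^ l = n) (y : Fin r → ℝ) :
    upperCorner N y ∈ region l r n ↔ symmP l (fun k => (upperCorner N y k : ℝ) / N) ≤ 1 := by
  rw [mem_region hl hlr, symmP_natCast_div, div_le_one (by positivity), hNn, Nat.cast_le]
  exact and_iff_right fun k => Nat.le_add_left 1 _

/-- Averages over the dilated lattice converge to integrals over the continuous region. -/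
theorem tendsto_sum_region_div (hr : 2 ≤ r) (hl : 1 ≤ l) (hlr : l < r)
    {w : ℕ → (Fin r → ℕ) → ℝ} {W : (Fin r → ℝ) → ℝ}
    (hw1 : ∀ n, ∀ i ∈ region l r n, |w n i| ≤ 1)
    (hwW : ∀ y : Fin r → ℝ, (∀ k, 0 < y k) →
      Tendsto (fun n : ℕ => w n (upperCorner ((n : ℝ) ^ (1 / (l : ℝ))) y)) atTop (𝓝 (W y))) :
    Tendsto (fun n : ℕ => (∑ i ∈ region l r n, w n i) / (n : ℝ) ^ ((r : ℝ) / (l : ℝ))) atTop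
      (𝓝 (∫ y in contRegion l r 1, W y)) := by
  have hl0 : (0 : ℝ) < l := by exact_mod_cast hl
  set N : ℕ → ℝ := fun n => (n : ℝ) ^ (1 / (l : ℝ)) with hN
  have hNl : ∀ n, N n ^ l = n := by
    intro n
    rw [hN, ← Real.rpow_natCast, ← Real.rpow_mul n.cast_nonneg, one_div_mul_cancel hl0.ne',
      Real.rpow_one]
  have hNr : ∀ n : ℕ, N n ^ r = (n : ℝ) ^ ((r : ℝ) / (l : ℝ)) := by
    intro n
    rw [hN, ← Real.rpow_natCast, ← Real.rpow_mul n.cast_nonneg]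
    congr 1
    ring
  have hNtop : Tendsto N atTop atTop :=
    (tendsto_rpow_atTop (by positivity)).comp tendsto_natCast_atTop_atTop
  have hpos := fun n => (isDown_region hl hlr.le n).pos
  have hDm := measurableSet_contRegion l r 1
  have hmain : Tendsto (fun n => ∫ y, ∑ i ∈ region l r n,
      (latticeCube (N n) i).indicator (fun _ => w n i) y) atTop
      (𝓝 (∫ y, (contRegion l r 1).indicator W y)) := by
    -- The step functions vanish off the region: the upper corner dominates y, so if it lies in the
    -- discrete region then P_l(y) ≤ 1.
    refine tendsto_integral_filter_of_dominated_convergence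
      ((contRegion l r 1).indicator fun _ => (1 : ℝ)) ?_ ?_ ?_ ?_
    · exact Eventually.of_forall fun n => (measurable_sum_latticeCube _ _).aestronglyMeasurable
    · filter_upwards [hNtop.eventually_gt_atTop 0] with n hn
      refine ae_of_all _ fun y => ?_
      by_cases h : (∀ k, 0 ≤ y k) ∧ upperCorner (N n) y ∈ region l r n
      · rw [sum_latticeCube_of_mem hn (hpos n) _ h.1 h.2]
        have hyD : y ∈ contRegion l r 1 := by
          refine ⟨h.1, (symmP_mono_real h.1 fun k => ?_).trans
            ((upperCorner_mem_region_iff hl hlr.le hn (hNl n) y).1 h.2)⟩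
          rw [le_div_iff₀ hn]
          have := (Nat.lt_floor_add_one (N n * y k)).le
          simp only [upperCorner]
          push_cast
          linarith
        rw [Set.indicator_of_mem hyD]
        exact hw1 n _ h.2
      · rw [sum_latticeCube_of_notMem hn (hpos n) _ h, norm_zero]
        exact Set.indicator_nonneg (fun _ _ => zero_le_one) _
    · rw [integrable_indicator_iff hDm]
      exact integrableOn_const (volume_contRegion_lt_top hr hl hlr).ne
    -- Off the null set P_l(y) = 1, membership of the upper corner in the region is eventually
    -- decided by y.
    · filter_upwards [ae_ne_zero (r := r), ae_symmP_ne_one hr hl hlr] with y hy0 hy1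
      by_cases hy : ∀ k, 0 ≤ y k
      · have hlim : Tendsto (fun n => symmP l fun k => (upperCorner (N n) y k : ℝ) / N n) atTop
            (𝓝 (symmP l y)) :=
          (continuous_symmP.tendsto y).comp
            (tendsto_pi_nhds.2 fun k => tendsto_upperCorner_div hNtop hy k)
        rcases lt_or_gt_of_ne (hy1 hy) with h | h
        · rw [Set.indicator_of_mem (show y ∈ contRegion l r 1 from ⟨hy, h.le⟩)]
          refine (hwW y fun k => lt_of_le_of_ne (hy k) (hy0 k).symm).congr' ?_
          filter_upwards [hlim.eventually (gt_mem_nhds h), hNtop.eventually_gt_atTop 0] with n hn hn0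
          rw [sum_latticeCube_of_mem hn0 (hpos n) _ hy
            ((upperCorner_mem_region_iff hl hlr.le hn0 (hNl n) y).2 hn.le)]
        · rw [Set.indicator_of_notMem (fun h' : y ∈ contRegion l r 1 => h.not_ge h'.2)]
          refine tendsto_const_nhds.congr' ?_
          filter_upwards [hlim.eventually (lt_mem_nhds h), hNtop.eventually_gt_atTop 0] with n hn hn0
          rw [sum_latticeCube_of_notMem hn0 (hpos n)]
          rw [upperCorner_mem_region_iff hl hlr.le hn0 (hNl n) y]
          exact fun h' => hn.not_ge h'.2
      · rw [Set.indicator_of_notMem (fun h' : y ∈ contRegion l r 1 => hy h'.1)]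
        refine tendsto_const_nhds.congr' ?_
        filter_upwards [hNtop.eventually_gt_atTop 0] with n hn0
        rw [sum_latticeCube_of_notMem hn0 (hpos n)]
        exact fun h' => hy h'.1
  rw [integral_indicator hDm] at hmain
  refine hmain.congr' ?_
  filter_upwards [hNtop.eventually_gt_atTop 0] with n hn
  rw [integral_sum_latticeCube hn, hNr]

theorem tendsto_card_region_div (hr : 2 ≤ r) (hl : 1 ≤ l) (hlr : l < r) :
    Tendsto (fun n : ℕ => ((region l r n).card : ℝ) / (n : ℝ) ^ ((r : ℝ) / (l : ℝ))) atTop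
      (𝓝 (volume.real (contRegion l r 1))) := by
  have := tendsto_sum_region_div hr hl hlr (w := fun _ _ => 1) (W := fun _ => 1)
    (by simp) (fun _ _ => tendsto_const_nhds)
  simpa using this

theorem volume_real_contRegion_pos (hr : 2 ≤ r) (hl : 1 ≤ l) (hlr : l < r) :
    0 < volume.real (contRegion l r 1) :=
  ENNReal.toReal_pos (volume_contRegion_pos hl hlr.le).ne' (volume_contRegion_lt_top hr hl hlr).ne

/-- If a sum over the region divided by the volume of the dilation converges, so does the average. -/
theorem tendsto_average_of_tendsto (hr : 2 ≤ r) (hl : 1 ≤ l) (hlr : l < r) {s : ℕ → ℝ} {c : ℝ}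
    (h : Tendsto (fun n : ℕ => s n / (n : ℝ) ^ ((r : ℝ) / (l : ℝ))) atTop (𝓝 c)) :
    Tendsto (fun n => s n / (region l r n).card) atTop
      (𝓝 (c / volume.real (contRegion l r 1))) := by
  refine (h.div (tendsto_card_region_div hr hl hlr)
    (volume_real_contRegion_pos hr hl hlr).ne').congr' ?_
  filter_upwards [eventually_gt_atTop 0] with n hn
  have : (0 : ℝ) < (n : ℝ) ^ ((r : ℝ) / (l : ℝ)) := by positivity
  simp only [Pi.div_apply]
  rw [div_div_div_cancel_right₀ this.ne']

/-- Points of the region with a small coordinate are negligible, for `l < r`. -/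
theorem tendsto_slab_of_lt (hr : 2 ≤ r) (hl : 1 ≤ l) (hlr : l < r) (m : ℕ) :
    Tendsto (fun n => (((region l r n).filter fun i => ∃ k, i k ≤ m).card : ℝ) /
      (region l r n).card) atTop (𝓝 0) := by
  -- For y with positive coordinates the upper corner eventually exceeds m in each coordinate, so
  -- the limit function is 0.
  have h := tendsto_sum_region_div hr hl hlr (W := fun _ => 0)
    (w := fun _ i => if ∃ k, i k ≤ m then 1 else 0)
    (fun n i _ => by split_ifs <;> simp) (fun y hy => by
      refine tendsto_const_nhds.congr' ?_
      have hl0 : (0 : ℝ) < l := by exact_mod_cast hl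
      have hNtop : Tendsto (fun n : ℕ => (n : ℝ) ^ (1 / (l : ℝ))) atTop atTop :=
        (tendsto_rpow_atTop (by positivity)).comp tendsto_natCast_atTop_atTop
      have : ∀ᶠ n : ℕ in atTop, ∀ k, (m : ℝ) ≤ (n : ℝ) ^ (1 / (l : ℝ)) * y k :=
        eventually_all.2 fun k => (hNtop.atTop_mul_const (hy k)).eventually_ge_atTop _
      filter_upwards [this] with n hn
      rw [if_neg]
      push Not
      intro k
      have := Nat.le_floor (hn k)
      simp only [upperCorner]
      omega)
  have h2 := tendsto_average_of_tendsto hr hl hlr h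
  simpa using h2

/-- Moments of the product of the coordinates, for `l < r`. -/
theorem tendsto_moment_of_lt (hr : 2 ≤ r) (hl : 1 ≤ l) (hlr : l < r) {β : ℝ} (hβ : 0 < β) :
    Tendsto (fun n : ℕ => (∑ i ∈ region l r n,
      (((∏ k, i k : ℕ) : ℝ) / (n : ℝ) ^ ((r : ℝ) / (l : ℝ))) ^ β) / (region l r n).card) atTop
      (𝓝 (∫ x, x ^ β ∂limitLaw l r)) := by
  have hl0 : (0 : ℝ) < l := by exact_mod_cast hl
  have hNtop : Tendsto (fun n : ℕ => (n : ℝ) ^ (1 / (l : ℝ))) atTop atTop :=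
    (tendsto_rpow_atTop (by positivity)).comp tendsto_natCast_atTop_atTop
  have hlim : ∫ x, x ^ β ∂limitLaw l r =
      (∫ y in contRegion l r 1, (∏ k, y k) ^ β) / volume.real (contRegion l r 1) := by
    rw [limitLaw, if_pos hlr, integral_map (by fun_prop)
      ((Real.continuous_rpow_const hβ.le).aestronglyMeasurable), ProbabilityTheory.cond,
      integral_smul_measure, ENNReal.toReal_inv, smul_eq_mul, div_eq_inv_mul, Measure.real]
  rw [hlim]
  refine tendsto_average_of_tendsto hr hl hlr (tendsto_sum_region_div hr hl hlr ?_ ?_)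
  · intro n i hi
    have h0 : 0 ≤ ((∏ k, i k : ℕ) : ℝ) / (n : ℝ) ^ ((r : ℝ) / (l : ℝ)) := by positivity
    rw [abs_of_nonneg (Real.rpow_nonneg h0 _)]
    refine Real.rpow_le_one h0 (div_le_one_of_le₀ (prod_le_rpow hl hlr.le hi) (by positivity)) hβ.le
  · intro y hy
    have h1 : Tendsto (fun n : ℕ => ∏ k, (upperCorner ((n : ℝ) ^ (1 / (l : ℝ))) y k : ℝ) /
        (n : ℝ) ^ (1 / (l : ℝ))) atTop (𝓝 (∏ k, y k)) :=
      tendsto_finsetProd _ fun k _ => tendsto_upperCorner_div hNtop (fun k => (hy k).le) k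
    refine (h1.rpow_const (Or.inr hβ.le)).congr fun n => ?_
    rw [Finset.prod_div_distrib, Finset.prod_const, Finset.card_univ, Fintype.card_fin,
      ← Real.rpow_natCast, ← Real.rpow_mul n.cast_nonneg]
    push_cast
    congr 3
    ring

theorem moment_limitLaw_pos_of_lt (hr : 2 ≤ r) (hl : 1 ≤ l) (hlr : l < r) {β : ℝ} (hβ : 0 < β) :
    0 < ∫ x, x ^ β ∂limitLaw l r := by
  have hvol := volume_contRegion_pos hl hlr.le
  have hfin := volume_contRegion_lt_top hr hl hlr
  have hDm := measurableSet_contRegion l r 1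
  rw [limitLaw, if_pos hlr, integral_map (by fun_prop)
      ((Real.continuous_rpow_const hβ.le).aestronglyMeasurable), ProbabilityTheory.cond,
      integral_smul_measure, ENNReal.toReal_inv, smul_eq_mul]
  refine mul_pos (inv_pos.2 (volume_real_contRegion_pos hr hl hlr)) ?_
  have hnn : ∀ y ∈ contRegion l r 1, 0 ≤ (∏ k, y k) ^ β := fun y hy =>
    Real.rpow_nonneg (Finset.prod_nonneg fun k _ => hy.1 k) _
  rw [setIntegral_pos_iff_support_of_nonneg_ae]
  · refine lt_of_lt_of_le hvol (measure_mono_ae ?_)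
    filter_upwards [ae_ne_zero (r := r)] with y hy0 hy
    refine ⟨?_, hy⟩
    exact (Real.rpow_pos_of_pos (Finset.prod_pos fun k _ =>
      lt_of_le_of_ne (hy.1 k) (hy0 k).symm) _).ne'
  · exact (ae_restrict_iff' hDm).2 (ae_of_all _ hnn)
  · refine IntegrableOn.of_bound hfin ?_ 1 ((ae_restrict_iff' hDm).2 (ae_of_all _ fun y hy => ?_))
    · have : Continuous fun y : Fin r → ℝ => (∏ k, y k) ^ β :=
        (by fun_prop : Continuous fun y : Fin r → ℝ => ∏ k, y k).rpow_const fun _ => Or.inr hβ.le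
      exact this.aestronglyMeasurable
    · rw [Real.norm_of_nonneg (hnn y hy)]
      exact Real.rpow_le_one (Finset.prod_nonneg fun k _ => hy.1 k)
        (prod_le_one_of_mem_contRegion hl hlr.le hy) hβ.le

end

/-! ### The case l = r: the multiplicative hyperbola. -/

/-- Positive integer points with product of coordinates at most `n`. -/
def hyperbola (r n : ℕ) : Finset (Fin r → ℕ) :=
  (Fintype.piFinset fun _ => Finset.Icc 1 n).filter fun i => ∏ k, i k ≤ n

theorem mem_hyperbola {r n : ℕ} (i : Fin r → ℕ) :
    i ∈ hyperbola r n ↔ (∀ k, 1 ≤ i k) ∧ ∏ k, i k ≤ n := by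
  simp only [hyperbola, Finset.mem_filter, Fintype.mem_piFinset, Finset.mem_Icc]
  refine ⟨fun h => ⟨fun k => (h.1 k).1, h.2⟩, fun h => ⟨fun k => ⟨h.1 k, ?_⟩, h.2⟩⟩
  exact (Finset.single_le_prod' (f := i) (fun j _ => h.1 j) (Finset.mem_univ k)).trans h.2

theorem region_self (r n : ℕ) : region r r n = hyperbola r n := by
  have h : Finset.powersetCard r (Finset.univ : Finset (Fin r)) = {Finset.univ} := by
    have := Finset.powersetCard_self (Finset.univ : Finset (Fin r))
    simpa using this
  simp [region, hyperbola, symmP_eq_sum, h]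

/-- The distinguished coordinate k is arbitrary because the slab estimate fibres over each
coordinate in turn. -/
theorem sum_hyperbola_succ {r n : ℕ} (k : Fin (r + 1)) (g : (Fin (r + 1) → ℕ) → ℝ) :
    ∑ i ∈ hyperbola (r + 1) n, g i =
      ∑ i ∈ hyperbola r n, ∑ j ∈ Finset.Icc 1 (n / ∏ k, i k), g (k.insertNth j i) := by
  rw [Finset.sum_sigma']
  refine Finset.sum_nbij' (fun i => ⟨k.removeNth i, i k⟩) (fun x => k.insertNth x.2 x.1) ?_ ?_ ?_ ?_ ?_
  · intro i hi
    rw [mem_hyperbola, Fin.prod_univ_succAbove _ k] at hi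
    have hpos : 0 < ∏ j, i (k.succAbove j) := Finset.prod_pos fun j _ => hi.1 _
    simp only [Finset.mem_sigma, mem_hyperbola, Finset.mem_Icc, Fin.removeNth]
    refine ⟨⟨fun j => hi.1 _, ?_⟩, hi.1 k, (Nat.le_div_iff_mul_le hpos).2 hi.2⟩
    exact (Nat.le_mul_of_pos_left _ (hi.1 k)).trans hi.2
  · rintro ⟨i, j⟩ hx
    simp only [Finset.mem_sigma, mem_hyperbola, Finset.mem_Icc] at hx
    have hpos : 0 < ∏ j, i j := Finset.prod_pos fun j _ => hx.1.1 _
    rw [mem_hyperbola, Fin.prod_univ_succAbove _ k]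
    simp only [Fin.insertNth_apply_same, Fin.insertNth_apply_succAbove]
    refine ⟨fun a => ?_, (Nat.le_div_iff_mul_le hpos).1 hx.2.2⟩
    rcases Fin.eq_self_or_eq_succAbove k a with rfl | ⟨b, rfl⟩
    · simpa using hx.2.1
    · simpa using hx.1.1 b
  · intro i _
    simp
  · rintro ⟨i, j⟩ _
    simp
  · intro i _
    simp

theorem prod_insertNth {r : ℕ} (k : Fin (r + 1)) (j : ℕ) (i : Fin r → ℕ) :
    ∏ a, (k.insertNth j i : Fin (r + 1) → ℕ) a = j * ∏ a, i a := by
  rw [Fin.prod_univ_succAbove _ k]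
  simp

theorem card_hyperbola_succ (r n : ℕ) :
    ((hyperbola (r + 1) n).card : ℝ) = ∑ i ∈ hyperbola r n, ((n / ∏ k, i k : ℕ) : ℝ) := by
  have := sum_hyperbola_succ (n := n) (0 : Fin (r + 1)) (fun _ => 1)
  simpa using this

theorem card_hyperbola_succ_succ (r n : ℕ) :
    ((hyperbola (r + 2) n).card : ℝ) = ∑ i ∈ hyperbola r n,
      ∑ j ∈ Finset.Icc 1 (n / ∏ k, i k), ((n / (∏ k, i k) / j : ℕ) : ℝ) := by
  rw [card_hyperbola_succ, sum_hyperbola_succ (0 : Fin (r + 1))]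
  refine Finset.sum_congr rfl fun i _ => Finset.sum_congr rfl fun j _ => ?_
  rw [prod_insertNth, mul_comm, Nat.div_div_eq_div_mul]

/-- The sum is at least M log(M + 1) - M, which beats KM for M ≥ M0; the constant C = K M0 covers
smaller M. -/
theorem exists_le_sum_div (K : ℝ) (hK : 0 ≤ K) :
    ∃ C : ℝ, ∀ M : ℕ, K * M ≤ ∑ j ∈ Finset.Icc 1 M, ((M / j : ℕ) : ℝ) + C := by
  have hlog : Tendsto (fun M : ℕ => Real.log ((M + 1 : ℕ) : ℝ)) atTop atTop :=
    Real.tendsto_log_atTop.comp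
      (tendsto_natCast_atTop_atTop.comp (tendsto_add_atTop_nat 1))
  obtain ⟨M0, hM0⟩ := eventually_atTop.1 (hlog.eventually_ge_atTop (K + 1))
  refine ⟨K * M0, fun M => ?_⟩
  rcases le_or_gt M0 M with h | h
  · have h1 : K + 1 ≤ ∑ j ∈ Finset.Icc 1 M, ((j : ℝ))⁻¹ := by
      have := (hM0 M h).trans (log_add_one_le_harmonic M)
      rw [harmonic_eq_sum_Icc] at this
      push_cast at this
      exact this
    have h2 : (M : ℝ) * ∑ j ∈ Finset.Icc 1 M, ((j : ℝ))⁻¹ - M ≤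
        ∑ j ∈ Finset.Icc 1 M, ((M / j : ℕ) : ℝ) := by
      have h3 : ∑ j ∈ Finset.Icc 1 M, ((M : ℝ) * (j : ℝ)⁻¹ - 1) ≤
          ∑ j ∈ Finset.Icc 1 M, ((M / j : ℕ) : ℝ) := by
        refine Finset.sum_le_sum fun j _ => ?_
        rw [← Nat.floor_div_eq_div (K := ℝ), ← div_eq_mul_inv]
        linarith [Nat.lt_floor_add_one ((M : ℝ) / j)]
      rw [Finset.sum_sub_distrib, ← Finset.mul_sum] at h3
      simpa using h3
    have h4 := mul_le_mul_of_nonneg_left h1 (Nat.cast_nonneg (α := ℝ) M)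
    have : 0 ≤ K * M0 := by positivity
    linarith
  · have h1 : K * M ≤ K * M0 := by gcongr
    have h2 : 0 ≤ ∑ j ∈ Finset.Icc 1 M, ((M / j : ℕ) : ℝ) := by positivity
    linarith

theorem eventually_mul_card_hyperbola_le (r : ℕ) : ∀ K : ℝ, 0 ≤ K →
    ∀ᶠ n in atTop, K * (hyperbola r n).card ≤ (hyperbola (r + 1) n).card := by
  induction r with
  | zero =>
    intro K hK
    filter_upwards [tendsto_natCast_atTop_atTop.eventually_ge_atTop K,
      eventually_ge_atTop 1] with n hn hn1
    have h0 : hyperbola 0 n = Finset.univ := by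
      ext i
      simp [mem_hyperbola, hn1, eq_iff_true_of_subsingleton]
    rw [card_hyperbola_succ, h0]
    simpa using hn
  | succ r ih =>
    intro K hK
    -- Two coordinates are summed out at once. The extra 1 in K + 1 pays for the error C |H_r|,
    -- which the induction hypothesis bounds by |H_(r+1)|.
    obtain ⟨C, hC⟩ := exists_le_sum_div (K + 1) (by linarith)
    filter_upwards [ih |C| (abs_nonneg _)] with n hn
    have h1 : (K + 1) * (hyperbola (r + 1) n).card ≤
        (hyperbola (r + 2) n).card + C * (hyperbola r n).card := by
      rw [card_hyperbola_succ_succ, card_hyperbola_succ, Finset.mul_sum, mul_comm C,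
        ← nsmul_eq_mul, ← Finset.sum_const, ← Finset.sum_add_distrib]
      exact Finset.sum_le_sum fun i _ => hC _
    have h2 : C * (hyperbola r n).card ≤ |C| * (hyperbola r n).card := by
      gcongr
      exact le_abs_self C
    linarith

theorem hyperbola_card_pos {r n : ℕ} (hn : 1 ≤ n) : 0 < (hyperbola r n).card :=
  Finset.card_pos.2 ⟨fun _ => 1, (mem_hyperbola _).2 ⟨fun _ => le_rfl, by simpa using hn⟩⟩

theorem tendsto_card_hyperbola_div (r : ℕ) :
    Tendsto (fun n => ((hyperbola r n).card : ℝ) / (hyperbola (r + 1) n).card) atTop (𝓝 0) := by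
  rw [Metric.tendsto_nhds]
  intro ε hε
  filter_upwards [eventually_mul_card_hyperbola_le r (2 / ε) (by positivity),
    eventually_ge_atTop 1] with n hn hn1
  have hpos : (0 : ℝ) < (hyperbola (r + 1) n).card := by exact_mod_cast hyperbola_card_pos hn1
  rw [Real.dist_eq, sub_zero, abs_of_nonneg (by positivity), div_lt_iff₀ hpos]
  rw [div_mul_eq_mul_div, div_le_iff₀ hε] at hn
  nlinarith

/-- There are r + 1 choices for the small coordinate and at most m values for it; the others form a
point of the lower hyperbola. -/
theorem card_hyperbola_slab_le (r n m : ℕ) :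
    (((hyperbola (r + 1) n).filter fun i => ∃ k, i k ≤ m).card : ℝ) ≤
      ((r + 1) * m) * (hyperbola r n).card := by
  have h1 : ((hyperbola (r + 1) n).filter fun i => ∃ k, i k ≤ m) ⊆
      Finset.univ.biUnion fun k => (hyperbola (r + 1) n).filter fun i => i k ≤ m := by
    intro i hi
    simp only [Finset.mem_filter, Finset.mem_biUnion, Finset.mem_univ, true_and] at hi ⊢
    obtain ⟨k, hk⟩ := hi.2
    exact ⟨k, hi.1, hk⟩
  have h2 : ∀ k, (((hyperbola (r + 1) n).filter fun i => i k ≤ m).card : ℝ) ≤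
      m * (hyperbola r n).card := by
    intro k
    rw [Finset.card_filter]
    push_cast
    rw [sum_hyperbola_succ k, mul_comm, ← nsmul_eq_mul, ← Finset.sum_const]
    refine Finset.sum_le_sum fun i _ => ?_
    simp only [Fin.insertNth_apply_same]
    rw [← Finset.sum_filter, Finset.sum_const, nsmul_one, Nat.cast_le]
    calc _ ≤ (Finset.Icc 1 m).card := Finset.card_le_card fun j hj => by
          simp only [Finset.mem_filter, Finset.mem_Icc] at hj ⊢
          exact ⟨hj.1.1, hj.2⟩
      _ = m := by simp
  calc _ ≤ ((∑ k, ((hyperbola (r + 1) n).filter fun i => i k ≤ m).card : ℕ) : ℝ) := by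
        exact_mod_cast (Finset.card_le_card h1).trans Finset.card_biUnion_le
    _ ≤ ∑ k : Fin (r + 1), (m : ℝ) * (hyperbola r n).card := by
        push_cast
        exact Finset.sum_le_sum fun k _ => h2 k
    _ = _ := by
        simp
        ring

/-- Points of the region with a small coordinate are negligible, for `l = r`. -/
theorem tendsto_slab_self {r : ℕ} (hr : 2 ≤ r) (m : ℕ) :
    Tendsto (fun n => (((region r r n).filter fun i => ∃ k, i k ≤ m).card : ℝ) /
      (region r r n).card) atTop (𝓝 0) := by
  obtain ⟨r, rfl⟩ : ∃ s, r = s + 1 := ⟨r - 1, by omega⟩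
  have h := (tendsto_card_hyperbola_div r).const_mul ((r + 1) * m : ℝ)
  rw [mul_zero] at h
  refine squeeze_zero (fun n => by positivity) (fun n => ?_) h
  simp only [region_self]
  rw [← mul_div_assoc]
  gcongr
  exact card_hyperbola_slab_le r n m

/-- A power sum approximated by an integral, with bounded error. -/
theorem abs_sum_rpow_sub_le {β T : ℝ} (hβ : 0 < β) {M : ℕ} (hT : 0 < T) (h1 : M ≤ T)
    (h2 : T ≤ M + 1) :
    |∑ j ∈ Finset.Icc 1 M, ((j : ℝ) / T) ^ β - M / (β + 1)| ≤ 1 := by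
  have hM0 : (0 : ℝ) ≤ M := M.cast_nonneg
  have hmono : MonotoneOn (fun x : ℝ => x ^ β) (Set.Icc 0 (0 + (M : ℕ))) :=
    fun x hx y _ hxy => Real.rpow_le_rpow hx.1 hxy hβ.le
  have hint : ∫ x in (0 : ℝ)..(0 + (M : ℕ)), x ^ β = (M : ℝ) * (M : ℝ) ^ β / (β + 1) := by
    rw [integral_rpow (Or.inl (by linarith)), zero_add, Real.zero_rpow (by linarith), sub_zero,
      Real.rpow_add_one' hM0 (by linarith), mul_comm]
  have hup := hmono.sum_le_integral
  have hlow := hmono.integral_le_sum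
  rw [hint] at hup hlow
  simp only [zero_add] at hup hlow
  have hS : ∑ j ∈ Finset.Icc 1 M, ((j : ℝ) / T) ^ β =
      (∑ j ∈ Finset.range M, ((j + 1 : ℕ) : ℝ) ^ β) / T ^ β := by
    rw [Finset.sum_div, Finset.range_eq_Ico, Finset.sum_Ico_add' (fun j : ℕ => (j : ℝ) ^ β / T ^ β)]
    refine Finset.sum_congr (by ext; simp) fun j _ => ?_
    rw [Real.div_rpow (Nat.cast_nonneg _) hT.le]
  have hshift : ∑ j ∈ Finset.range M, ((j + 1 : ℕ) : ℝ) ^ β =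
      ∑ j ∈ Finset.range M, ((j : ℕ) : ℝ) ^ β + (M : ℝ) ^ β := by
    have a := Finset.sum_range_succ (fun j : ℕ => (j : ℝ) ^ β) M
    have b := Finset.sum_range_succ' (fun j : ℕ => (j : ℝ) ^ β) M
    rw [Nat.cast_zero, Real.zero_rpow hβ.ne', add_zero] at b
    rw [← b, a]
  have hTβ : 0 < T ^ β := Real.rpow_pos_of_pos hT β
  have hMT : (M : ℝ) ^ β / T ^ β ≤ 1 := by
    rw [div_le_one hTβ]
    exact Real.rpow_le_rpow hM0 h1 hβ.le
  have hβ1 : 0 < β + 1 := by linarith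
  rw [abs_le, hS]
  constructor
  -- Since T ≤ M + 1, (M/T)^β ≥ (M/(M+1))^β ≥ (M/(M+1))^(β+1), the exponent being raised so that
  -- Bernoulli's inequality applies even if β < 1.
  · have hx : 1 + (β + 1) * (-(1 / ((M : ℝ) + 1))) ≤ (M : ℝ) ^ β / T ^ β := by
      have hb := one_add_mul_self_le_rpow_one_add (s := -(1 / ((M : ℝ) + 1))) (p := β + 1) (by
        rw [neg_le_neg_iff, div_le_one (by linarith)]
        linarith) (by linarith)
      refine hb.trans ?_
      have e : 1 + -(1 / ((M : ℝ) + 1)) = M / (M + 1) := by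
        field_simp
        ring
      rw [e, ← Real.div_rpow hM0 hT.le]
      have h0 : 0 ≤ (M : ℝ) / (M + 1) := by positivity
      have h01 : (M : ℝ) / (M + 1) ≤ 1 := by
        rw [div_le_one (by linarith)]
        linarith
      rw [Real.rpow_add_one' h0 (by linarith)]
      refine (mul_le_of_le_one_right (Real.rpow_nonneg h0 _) h01).trans ?_
      refine Real.rpow_le_rpow h0 ?_ hβ.le
      gcongr
    have h3 : (M : ℝ) * (M : ℝ) ^ β / (β + 1) / T ^ β ≤
        (∑ j ∈ Finset.range M, ((j + 1 : ℕ) : ℝ) ^ β) / T ^ β := by gcongr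
    have h4 : (M : ℝ) * (M : ℝ) ^ β / (β + 1) / T ^ β = M / (β + 1) * ((M : ℝ) ^ β / T ^ β) := by
      field_simp
    have h5 : M / (β + 1) * (1 + (β + 1) * (-(1 / ((M : ℝ) + 1)))) ≤
        M / (β + 1) * ((M : ℝ) ^ β / T ^ β) := by gcongr
    have h6 : M / (β + 1) * (1 + (β + 1) * (-(1 / ((M : ℝ) + 1)))) =
        M / (β + 1) - M / ((M : ℝ) + 1) := by
      field_simp
      ring
    have h7 : (M : ℝ) / (M + 1) ≤ 1 := by
      rw [div_le_one (by linarith)]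
      linarith
    linarith
  · rw [hshift, add_div]
    have h3 : (∑ j ∈ Finset.range M, ((j : ℕ) : ℝ) ^ β) / T ^ β ≤
        (M : ℝ) * (M : ℝ) ^ β / (β + 1) / T ^ β := by gcongr
    have h4 : (M : ℝ) * (M : ℝ) ^ β / (β + 1) / T ^ β = M / (β + 1) * ((M : ℝ) ^ β / T ^ β) := by
      field_simp
    have h5 : M / (β + 1) * ((M : ℝ) ^ β / T ^ β) ≤ M / (β + 1) :=
      mul_le_of_le_one_right (by positivity) hMT
    linarith

/-- On a fibre the normalised product is j/T with T = n / ∏ i, so its β-power sum is (fibre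
length)/(β + 1) up to 1. The errors add up to the number of fibres. -/
theorem abs_sum_hyperbola_rpow_sub_le {β : ℝ} (hβ : 0 < β) {n : ℕ} (hn : 1 ≤ n) (r : ℕ) :
    |∑ i ∈ hyperbola (r + 1) n, (((∏ k, i k : ℕ) : ℝ) / n) ^ β -
      (hyperbola (r + 1) n).card / (β + 1)| ≤ (hyperbola r n).card := by
  rw [sum_hyperbola_succ (0 : Fin (r + 1)), card_hyperbola_succ, Finset.sum_div,
    ← Finset.sum_sub_distrib]
  refine (Finset.abs_sum_le_sum_abs _ _).trans ?_
  rw [← nsmul_one (hyperbola r n).card, ← Finset.sum_const]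
  refine Finset.sum_le_sum fun i hi => ?_
  have hpos : 0 < ∏ k, i k := Finset.prod_pos fun k _ => ((mem_hyperbola i).1 hi).1 k
  have hposR : (0 : ℝ) < ((∏ k, i k : ℕ) : ℝ) := by exact_mod_cast hpos
  have hnR : (0 : ℝ) < n := by exact_mod_cast hn
  have hT : (0 : ℝ) < (n : ℝ) / ((∏ k, i k : ℕ) : ℝ) := by positivity
  have := abs_sum_rpow_sub_le hβ (M := n / ∏ k, i k) hT
    (by rw [← Nat.floor_div_eq_div (K := ℝ)]; exact Nat.floor_le hT.le)
    (by rw [← Nat.floor_div_eq_div (K := ℝ)]; exact (Nat.lt_floor_add_one _).le)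
  have e : ∀ j : ℕ, ((j * ∏ k, i k : ℕ) : ℝ) / n = j / ((n : ℝ) / ((∏ k, i k : ℕ) : ℝ)) := by
    intro j
    rw [Nat.cast_mul]
    field_simp
  simp only [prod_insertNth, e]
  exact this

theorem moment_limitLaw_self (r : ℕ) {β : ℝ} (hβ : 0 < β) :
    ∫ x, x ^ β ∂limitLaw r r = 1 / (β + 1) := by
  rw [limitLaw, if_neg (lt_irrefl r), ProbabilityTheory.cond, integral_smul_measure,
    Real.volume_Icc, integral_Icc_eq_integral_Ioc, ← intervalIntegral.integral_of_le zero_le_one,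
    integral_rpow (Or.inl (by linarith)), Real.zero_rpow (by linarith)]
  simp

/-- Moments of the product of the coordinates, for `l = r`. -/
theorem tendsto_moment_self {r : ℕ} (hr : 2 ≤ r) {β : ℝ} (hβ : 0 < β) :
    Tendsto (fun n : ℕ => (∑ i ∈ region r r n,
      (((∏ k, i k : ℕ) : ℝ) / (n : ℝ) ^ ((r : ℝ) / (r : ℝ))) ^ β) / (region r r n).card) atTop
      (𝓝 (∫ x, x ^ β ∂limitLaw r r)) := by
  have hr0 : (r : ℝ) ≠ 0 := by
    have : r ≠ 0 := by omega
    exact_mod_cast this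
  simp only [moment_limitLaw_self r hβ, div_self hr0, Real.rpow_one]
  obtain ⟨r, rfl⟩ : ∃ s, r = s + 1 := ⟨r - 1, by omega⟩
  simp only [region_self]
  rw [tendsto_iff_dist_tendsto_zero]
  refine squeeze_zero' (Eventually.of_forall fun n => dist_nonneg) ?_
    (tendsto_card_hyperbola_div r)
  filter_upwards [eventually_ge_atTop 1] with n hn
  have hpos : (0 : ℝ) < (hyperbola (r + 1) n).card := by exact_mod_cast hyperbola_card_pos hn
  have := abs_sum_hyperbola_rpow_sub_le hβ hn r
  rw [Real.dist_eq, le_div_iff₀ hpos, ← abs_of_pos hpos, ← abs_mul, abs_of_pos hpos, sub_mul,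
    div_mul_cancel₀ _ hpos.ne', one_div_mul_eq_div]
  exact this

/-! ### Slabs and moments for all 1 ≤ l ≤ r. -/

section
variable {r l : ℕ}

/-- Points of the region with a small coordinate are negligible. -/
theorem tendsto_slab (hr : 2 ≤ r) (hl : 1 ≤ l) (hlr : l ≤ r) (m : ℕ) :
    Tendsto (fun n => (((region l r n).filter fun i => ∃ k, i k ≤ m).card : ℝ) /
      (region l r n).card) atTop (𝓝 0) := by
  rcases hlr.lt_or_eq with h | rfl
  · exact tendsto_slab_of_lt hr hl h m
  · exact tendsto_slab_self hr m

/-- Moments of the product of the coordinates. -/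
theorem tendsto_moment (hr : 2 ≤ r) (hl : 1 ≤ l) (hlr : l ≤ r) {β : ℝ} (hβ : 0 < β) :
    Tendsto (fun n : ℕ => (∑ i ∈ region l r n,
      (((∏ k, i k : ℕ) : ℝ) / (n : ℝ) ^ ((r : ℝ) / (l : ℝ))) ^ β) / (region l r n).card) atTop
      (𝓝 (∫ x, x ^ β ∂limitLaw l r)) := by
  rcases hlr.lt_or_eq with h | rfl
  · exact tendsto_moment_of_lt hr hl h hβ
  · exact tendsto_moment_self hr hβ

theorem moment_limitLaw_pos (hr : 2 ≤ r) (hl : 1 ≤ l) (hlr : l ≤ r) {β : ℝ} (hβ : 0 < β) :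
    0 < ∫ x, x ^ β ∂limitLaw l r := by
  rcases hlr.lt_or_eq with h | rfl
  · exact moment_limitLaw_pos_of_lt hr hl h hβ
  · rw [moment_limitLaw_self l hβ]
    positivity

end

/-! ### The arithmetic factor: prime exponents and exceptional points. -/

section
variable {r : ℕ}

/-- The ratio of the least common multiple to the product. -/
noncomputable def lcmRatio (i : Fin r → ℕ) : ℝ := ((Finset.univ.lcm i : ℕ) : ℝ) / ((∏ k, i k : ℕ) : ℝ)

theorem lcmRatio_nonneg (i : Fin r → ℕ) : 0 ≤ lcmRatio i := by
  unfold lcmRatio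
  positivity

theorem lcmRatio_le_one (i : Fin r → ℕ) : lcmRatio i ≤ 1 := by
  unfold lcmRatio
  rcases Nat.eq_zero_or_pos (∏ k, i k) with h | h
  · rw [h]
    simp
  · exact div_le_one_of_le₀ (by exact_mod_cast Nat.le_of_dvd h (Finset.lcm_dvd_prod _ _))
      (Nat.cast_nonneg _)

theorem lcmRatio_rpow_le_one {β : ℝ} (hβ : 0 < β) (i : Fin r → ℕ) : lcmRatio i ^ β ≤ 1 :=
  Real.rpow_le_one (lcmRatio_nonneg i) (lcmRatio_le_one i) hβ.le

theorem lcmRatio_rpow_nonneg {β : ℝ} (i : Fin r → ℕ) : 0 ≤ lcmRatio i ^ β :=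
  Real.rpow_nonneg (lcmRatio_nonneg i) β

/-- Used at primes dividing at most one coordinate: there lcm and product have the same exponent, so
the ratio does not see them. -/
theorem sup_eq_sum_of_pairwise {x : Fin r → ℕ} (h : ∀ j k, j ≠ k → x j = 0 ∨ x k = 0) :
    Finset.univ.sup x = ∑ k, x k := by
  by_cases h0 : ∃ k, x k ≠ 0
  · obtain ⟨k, hk⟩ := h0
    have hz : ∀ j, j ≠ k → x j = 0 := fun j hj => (h j k hj).resolve_right hk
    rw [Finset.sum_eq_single k (fun j _ hj => hz j hj) (by simp)]
    refine le_antisymm (Finset.sup_le fun j _ => ?_) (Finset.le_sup (f := x) (Finset.mem_univ k))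
    by_cases hj : j = k
    · rw [hj]
    · simp [hz j hj]
  · push Not at h0
    have : x = fun _ => 0 := funext h0
    simp [this]

/-- The integer with prescribed exponents at the primes in `S`. -/
def primePowers (S : Finset Nat.Primes) (a : Nat.Primes → ℕ) : ℕ := ∏ p ∈ S, (p : ℕ) ^ a p

theorem primePowers_ne_zero (S : Finset Nat.Primes) (a : Nat.Primes → ℕ) : primePowers S a ≠ 0 :=
  Finset.prod_ne_zero_iff.2 fun p _ => pow_ne_zero _ p.2.ne_zero

theorem factorization_primePowers (S : Finset Nat.Primes) (a : Nat.Primes → ℕ) (q : Nat.Primes) :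
    (primePowers S a).factorization q = if q ∈ S then a q else 0 := by
  rw [primePowers, Nat.factorization_prod fun p _ => pow_ne_zero _ p.2.ne_zero,
    Finset.sum_apply']
  have : ∀ p ∈ S, ((p : ℕ) ^ a p).factorization q = if q = p then a p else 0 := by
    intro p _
    rw [p.2.factorization_pow]
    by_cases h : q = p
    · simp [h]
    · rw [if_neg h, Finsupp.single_eq_of_ne]
      exact fun h' => h (Subtype.ext h')
  rw [Finset.sum_congr rfl this, Finset.sum_ite_eq]

/-- Natural numbers are equal if their exponents at all primes agree. -/
theorem eq_of_factorization_primes {a b : ℕ} (ha : a ≠ 0) (hb : b ≠ 0)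
    (h : ∀ p : Nat.Primes, a.factorization p = b.factorization p) : a = b := by
  refine Nat.eq_of_factorization_eq ha hb fun p => ?_
  by_cases hp : p.Prime
  · exact h ⟨p, hp⟩
  · rw [Nat.factorization_eq_zero_of_not_prime _ hp, Nat.factorization_eq_zero_of_not_prime _ hp]

theorem primePowers_dvd {S : Finset Nat.Primes} {a b : Nat.Primes → ℕ} (h : ∀ p ∈ S, a p ≤ b p) :
    primePowers S a ∣ primePowers S b :=
  Finset.prod_dvd_prod_of_dvd _ _ fun p hp => pow_dvd_pow _ (h p hp)

theorem eq_primePowers_of_dvd {S : Finset Nat.Primes} {a : Nat.Primes → ℕ} {e : ℕ}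
    (h : e ∣ primePowers S a) :
    e = primePowers S (fun p => e.factorization p) ∧ ∀ p ∈ S, e.factorization p ≤ a p := by
  have he : e ≠ 0 := ne_zero_of_dvd_ne_zero (primePowers_ne_zero S a) h
  have hle : ∀ p : Nat.Primes, e.factorization p ≤ if p ∈ S then a p else 0 := by
    intro p
    rw [← factorization_primePowers]
    exact (Nat.factorization_le_iff_dvd he (primePowers_ne_zero S a)).2 h p
  constructor
  · refine eq_of_factorization_primes he (primePowers_ne_zero _ _) fun p => ?_
    rw [factorization_primePowers]
    have := hle p
    split_ifs at this ⊢
    · rfl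
    · omega
  · intro p hp
    have := hle p
    rwa [if_pos hp] at this

theorem lcm_ne_zero_of_forall {i : Fin r → ℕ} (hi : ∀ k, i k ≠ 0) : Finset.univ.lcm i ≠ 0 := by
  rw [Ne, Finset.lcm_eq_zero_iff]
  rintro ⟨k, -, hk⟩
  exact hi k hk

theorem prod_ne_zero_of_forall {i : Fin r → ℕ} (hi : ∀ k, i k ≠ 0) : ∏ k, i k ≠ 0 :=
  Finset.prod_ne_zero_iff.2 fun k _ => hi k

theorem lcmRatio_eq_of_factorization {i g : Fin r → ℕ} (hi : ∀ k, i k ≠ 0) (hg : ∀ k, g k ≠ 0)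
    (h : ∀ p : Nat.Primes, (∀ k, (i k).factorization p = (g k).factorization p) ∨
      ((∀ j k, j ≠ k → (i j).factorization p = 0 ∨ (i k).factorization p = 0) ∧
        ∀ k, (g k).factorization p = 0)) : lcmRatio i = lcmRatio g := by
  have hli := lcm_ne_zero_of_forall hi
  have hlg := lcm_ne_zero_of_forall hg
  have hpi := prod_ne_zero_of_forall hi
  have hpg := prod_ne_zero_of_forall hg
  have key : Finset.univ.lcm i * ∏ k, g k = Finset.univ.lcm g * ∏ k, i k := by
    refine eq_of_factorization_primes (mul_ne_zero hli hpg) (mul_ne_zero hlg hpi) fun p => ?_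
    rw [Nat.factorization_mul hli hpg, Nat.factorization_mul hlg hpi,
      Nat.factorization_prod fun k _ => hi k, Nat.factorization_prod fun k _ => hg k,
      Finsupp.add_apply, Finsupp.add_apply, Finset.sum_apply', Finset.sum_apply',
      Finset.factorization_lcm fun k _ => hi k, Finset.factorization_lcm fun k _ => hg k]
    rcases h p with h | ⟨h1, h2⟩
    · simp only [h]
    · rw [sup_eq_sum_of_pairwise h1]
      simp [h2]
  have hpi' : ((∏ k, i k : ℕ) : ℝ) ≠ 0 := by exact_mod_cast hpi
  have hpg' : ((∏ k, g k : ℕ) : ℝ) ≠ 0 := by exact_mod_cast hpg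
  rw [lcmRatio, lcmRatio, div_eq_div_iff hpi' hpg']
  exact_mod_cast key

theorem lcmRatio_primePowers (S : Finset Nat.Primes) (a : Fin r → Nat.Primes → ℕ) :
    lcmRatio (fun k => primePowers S (a k)) =
      ∏ p ∈ S, ((p : ℕ) : ℝ) ^ (((Finset.univ.sup fun k => a k p : ℕ) : ℤ) - ∑ k, (a k p : ℤ)) := by
  have h1 : Finset.univ.lcm (fun k => primePowers S (a k)) =
      primePowers S fun p => Finset.univ.sup fun k => a k p := by
    have h0 : ∀ k, primePowers S (a k) ≠ 0 := fun k => primePowers_ne_zero _ _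
    refine eq_of_factorization_primes (lcm_ne_zero_of_forall h0) (primePowers_ne_zero _ _)
      fun p => ?_
    rw [Finset.factorization_lcm fun k _ => h0 k]
    simp only [factorization_primePowers]
    split_ifs
    · rfl
    · simp
  rw [lcmRatio, h1]
  simp only [primePowers]
  rw [Finset.prod_comm]
  push_cast
  rw [← Finset.prod_div_distrib]
  refine Finset.prod_congr rfl fun p _ => ?_
  have hp : ((p : ℕ) : ℝ) ≠ 0 := by exact_mod_cast p.2.ne_zero
  rw [zpow_sub₀ hp, zpow_natCast, Finset.prod_pow_eq_pow_sum, ← Nat.cast_sum, zpow_natCast]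

/-- The primes up to `m`. -/
def primesUpTo (m : ℕ) : Finset Nat.Primes := (Finset.range (m + 1)).subtype Nat.Prime

theorem mem_primesUpTo {m : ℕ} {p : Nat.Primes} : p ∈ primesUpTo m ↔ (p : ℕ) ≤ m := by
  exact Finset.mem_subtype.trans (by rw [Finset.mem_range, Nat.lt_succ_iff])

/-- The product of the `m`-th powers of the primes up to `m`. -/
def truncModulus (m : ℕ) : ℕ := primePowers (primesUpTo m) fun _ => m

instance (m : ℕ) : NeZero (truncModulus m) := ⟨primePowers_ne_zero _ _⟩

/-- `i` is exceptional for `m` if `lcmRatio` may not be determined by residues modulo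
`truncModulus m`. -/
def IsExceptional (m : ℕ) (i : Fin r → ℕ) : Prop :=
  (∃ k, ∃ d ∈ Finset.Icc 2 m, d ^ (m + 1) ∣ i k) ∨ ∃ j k, j ≠ k ∧ ∃ d > m, d ∣ i j ∧ d ∣ i k

/-- Without exceptional divisors, a prime up to m has exponents at most m, which the gcd with
`truncModulus m` preserves. A prime above m divides at most one coordinate and drops out of the
ratio. -/
theorem lcmRatio_gcd {m : ℕ} {i : Fin r → ℕ} (hi : ∀ k, i k ≠ 0) (h : ¬ IsExceptional m i) :
    lcmRatio i = lcmRatio fun k => (i k).gcd (truncModulus m) := by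
  rw [IsExceptional, not_or] at h
  push Not at h
  obtain ⟨h1, h2⟩ := h
  have hQ : truncModulus m ≠ 0 := primePowers_ne_zero _ _
  refine lcmRatio_eq_of_factorization hi (fun k => Nat.gcd_ne_zero_left (hi k)) fun p => ?_
  have hg : ∀ k, ((i k).gcd (truncModulus m)).factorization p =
      min ((i k).factorization p) (if p ∈ primesUpTo m then m else 0) := by
    intro k
    rw [Nat.factorization_gcd (hi k) hQ, Finsupp.inf_apply, truncModulus, factorization_primePowers]
  by_cases hp : p ∈ primesUpTo m
  · left
    intro k
    rw [hg, if_pos hp, min_eq_left]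
    by_contra! hlt
    refine h1 k p (Finset.mem_Icc.2 ⟨p.2.two_le, mem_primesUpTo.1 hp⟩) ?_
    exact (p.2.pow_dvd_iff_le_factorization (hi k)).2 hlt
  · right
    refine ⟨fun j k hjk => ?_, fun k => by rw [hg, if_neg hp, Nat.min_zero]⟩
    rw [mem_primesUpTo, not_le] at hp
    by_contra! hne
    refine h2 j k hjk p hp ?_ ?_
    · exact (p.2.dvd_iff_one_le_factorization (hi j)).2 (Nat.one_le_iff_ne_zero.2 hne.1)
    · exact (p.2.dvd_iff_one_le_factorization (hi k)).2 (Nat.one_le_iff_ne_zero.2 hne.2)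

variable {R : Finset (Fin r → ℕ)}

theorem IsDown.card_pow_dvd_le (hR : IsDown R) (k : Fin r) {d : ℕ} (hd : 1 ≤ d) :
    ((R.filter fun i => d ∣ i k).card : ℝ) ≤ R.card * (1 / d) := by
  have h := hR.card_dvd_mul_le (Function.update (fun _ => 1) k d)
  rw [Finset.prod_update_of_mem (Finset.mem_univ k)] at h
  have h1 : (R.filter fun i => ∀ j, Function.update (fun _ => 1) k d j ∣ i j) =
      R.filter fun i => d ∣ i k := by
    refine Finset.filter_congr fun i _ => ⟨fun h => by simpa using h k, fun h j => ?_⟩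
    by_cases hj : j = k
    · subst hj
      simpa using h
    · simp [Function.update_of_ne hj]
  rw [h1] at h
  simp only [Finset.prod_const_one, mul_one] at h
  have hd0 : (0 : ℝ) < d := by exact_mod_cast hd
  rw [mul_one_div, le_div_iff₀ hd0]
  exact_mod_cast h

theorem IsDown.card_dvd_dvd_le (hR : IsDown R) {j k : Fin r} (hjk : j ≠ k) {d : ℕ} (hd : 1 ≤ d) :
    ((R.filter fun i => d ∣ i j ∧ d ∣ i k).card : ℝ) ≤ R.card * (((d : ℝ) ^ 2)⁻¹) := by
  have h := hR.card_dvd_mul_le fun a => if a = j ∨ a = k then d else 1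
  have h1 : (R.filter fun i => ∀ a, (if a = j ∨ a = k then d else 1) ∣ i a) =
      R.filter fun i => d ∣ i j ∧ d ∣ i k := by
    refine Finset.filter_congr fun i _ => ⟨fun h => ⟨by simpa using h j, by simpa using h k⟩,
      fun h a => ?_⟩
    split_ifs with ha
    · rcases ha with rfl | rfl
      · exact h.1
      · exact h.2
    · exact one_dvd _
  have h2 : ∏ a, (if a = j ∨ a = k then d else 1) = d ^ 2 := by
    rw [Finset.prod_ite, Finset.prod_const_one, mul_one, Finset.prod_const]
    congr 1
    have : (Finset.univ.filter fun a => a = j ∨ a = k) = {j, k} := by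
      ext a
      simp
    rw [this, Finset.card_pair hjk]
  rw [h1, h2] at h
  have hd0 : (0 : ℝ) < (d : ℝ) ^ 2 := by positivity
  rw [← div_eq_mul_inv, le_div_iff₀ hd0]
  exact_mod_cast h

open scoped Classical in
/-- Few points of a down-closed set are exceptional. -/
theorem IsDown.card_exceptional_le (hR : IsDown R) {m : ℕ} (hm : 1 ≤ m) :
    ((R.filter fun i => IsExceptional m i).card : ℝ) ≤
      R.card * (r * (m * (1 / 2 ^ (m + 1))) + r * (r * (1 / m))) := by
  -- Only makes the range of common divisors finite; m is added so that m ≤ B.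
  set B : ℕ := m + R.sup fun i => Finset.univ.sup i with hB
  have hiB : ∀ i ∈ R, ∀ k, i k ≤ B := fun i hi k =>
    ((Finset.le_sup (f := i) (Finset.mem_univ k)).trans
      (Finset.le_sup (f := fun i : Fin r → ℕ => Finset.univ.sup i) hi)).trans (Nat.le_add_left _ _)
  -- A union bound over all d, prime or not: d^(m+1) divides one coordinate with density at most
  -- 2^(-(m+1)), and d divides two with density at most 1/d², which sums over d > m to at most 1/m.
  have hsub : (R.filter fun i => IsExceptional m i) ⊆
      (Finset.univ.biUnion fun k => (Finset.Icc 2 m).biUnion fun d =>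
        R.filter fun i => d ^ (m + 1) ∣ i k) ∪
      (Finset.univ.biUnion fun j => (Finset.univ.erase j).biUnion fun k =>
        (Finset.Ioc m B).biUnion fun d => R.filter fun i => d ∣ i j ∧ d ∣ i k) := by
    intro i hi
    rw [Finset.mem_filter] at hi
    obtain ⟨hiR, ⟨k, d, hd, hdk⟩ | ⟨j, k, hjk, d, hd, hdj, hdk⟩⟩ := hi
    · simp only [Finset.mem_union, Finset.mem_biUnion, Finset.mem_filter]
      exact Or.inl ⟨k, Finset.mem_univ k, d, hd, hiR, hdk⟩
    · simp only [Finset.mem_union, Finset.mem_biUnion, Finset.mem_filter]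
      refine Or.inr ⟨j, Finset.mem_univ j, k, Finset.mem_erase.2 ⟨hjk.symm, Finset.mem_univ k⟩, d,
        Finset.mem_Ioc.2 ⟨hd, ?_⟩, hiR, hdj, hdk⟩
      exact (Nat.le_of_dvd (hR.pos i hiR k) hdk).trans (hiB i hiR k)
  have h1 : ((Finset.univ.biUnion fun k => (Finset.Icc 2 m).biUnion fun d =>
        R.filter fun i => d ^ (m + 1) ∣ i k).card : ℝ) ≤
      R.card * (r * (m * (1 / 2 ^ (m + 1)))) := by
    calc _ ≤ ((∑ k : Fin r, ∑ d ∈ Finset.Icc 2 m,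
          (R.filter fun i => d ^ (m + 1) ∣ i k).card : ℕ) : ℝ) := by
          exact_mod_cast Finset.card_biUnion_le.trans
            (Finset.sum_le_sum fun k _ => Finset.card_biUnion_le)
      _ ≤ ∑ k : Fin r, ∑ d ∈ Finset.Icc 2 m, (R.card : ℝ) * (1 / 2 ^ (m + 1)) := by
          push_cast
          refine Finset.sum_le_sum fun k _ => Finset.sum_le_sum fun d hd => ?_
          have hd2 : 2 ≤ d := (Finset.mem_Icc.1 hd).1
          refine (hR.card_pow_dvd_le k (Nat.one_le_pow _ _ (by omega))).trans ?_
          push_cast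
          have : (2 : ℝ) ≤ d := by exact_mod_cast hd2
          gcongr
      _ ≤ _ := by
          simp only [Finset.sum_const, Finset.card_univ, Fintype.card_fin, Nat.card_Icc,
            nsmul_eq_mul]
          have : ((m + 1 - 2 : ℕ) : ℝ) ≤ m := by exact_mod_cast (by omega)
          calc (r : ℝ) * (((m + 1 - 2 : ℕ) : ℝ) * (R.card * (1 / 2 ^ (m + 1))))
              ≤ (r : ℝ) * ((m : ℝ) * (R.card * (1 / 2 ^ (m + 1)))) := by gcongr
            _ = _ := by ring
  have h2 : ((Finset.univ.biUnion fun j => (Finset.univ.erase j).biUnion fun k =>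
        (Finset.Ioc m B).biUnion fun d => R.filter fun i => d ∣ i j ∧ d ∣ i k).card : ℝ) ≤
      R.card * (r * (r * (1 / m))) := by
    have hsq : ∑ d ∈ Finset.Ioc m B, ((d : ℝ) ^ 2)⁻¹ ≤ 1 / m := by
      refine (sum_Ioc_inv_sq_le_sub (by omega) (Nat.le_add_right _ _)).trans ?_
      rw [one_div]
      have : 0 ≤ ((m + R.sup fun i => Finset.univ.sup i : ℕ) : ℝ)⁻¹ := by positivity
      linarith
    calc _ ≤ ((∑ j : Fin r, ∑ k ∈ Finset.univ.erase j, ∑ d ∈ Finset.Ioc m B,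
          (R.filter fun i => d ∣ i j ∧ d ∣ i k).card : ℕ) : ℝ) := by
          exact_mod_cast Finset.card_biUnion_le.trans
            (Finset.sum_le_sum fun j _ => Finset.card_biUnion_le.trans
              (Finset.sum_le_sum fun k _ => Finset.card_biUnion_le))
      _ ≤ ∑ j : Fin r, ∑ k ∈ Finset.univ.erase j, (R.card : ℝ) * (1 / m) := by
          push_cast
          refine Finset.sum_le_sum fun j _ => Finset.sum_le_sum fun k hk => ?_
          calc _ ≤ ∑ d ∈ Finset.Ioc m B, (R.card : ℝ) * ((d : ℝ) ^ 2)⁻¹ :=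
                Finset.sum_le_sum fun d hd => hR.card_dvd_dvd_le (Finset.mem_erase.1 hk).1.symm
                  (by have := (Finset.mem_Ioc.1 hd).1; omega)
            _ ≤ _ := by
                rw [← Finset.mul_sum]
                gcongr
      _ ≤ ∑ j : Fin r, ∑ k : Fin r, (R.card : ℝ) * (1 / m) := by
          refine Finset.sum_le_sum fun j _ => ?_
          exact Finset.sum_le_sum_of_subset_of_nonneg (Finset.erase_subset _ _)
            fun _ _ _ => by positivity
      _ = _ := by
          simp
          ring
  have h3 := (Nat.cast_le (α := ℝ)).2 ((Finset.card_le_card hsub).trans (Finset.card_union_le _ _))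
  rw [Nat.cast_add] at h3
  rw [mul_add]
  exact h3.trans (add_le_add h1 h2)

theorem tendsto_exceptional_bound (r : ℕ) :
    Tendsto (fun m : ℕ => (r : ℝ) * (m * (1 / 2 ^ (m + 1))) + r * (r * (1 / m))) atTop (𝓝 0) := by
  have h1 : Tendsto (fun m : ℕ => (m : ℝ) * (1 / 2 ^ (m + 1))) atTop (𝓝 0) := by
    have := (tendsto_self_mul_const_pow_of_lt_one (r := (1 / 2 : ℝ)) (by norm_num)
      (by norm_num)).mul_const (1 / 2)
    rw [zero_mul] at this
    refine this.congr fun m => ?_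
    rw [pow_succ, one_div_pow]
    field_simp
  have h2 : Tendsto (fun m : ℕ => 1 / (m : ℝ)) atTop (𝓝 0) := tendsto_one_div_atTop_nhds_zero_nat
  simpa using (h1.const_mul (r : ℝ)).add ((h2.const_mul (r : ℝ)).const_mul (r : ℝ))

end

/-! ### Decoupling size from arithmetic, and the mean of f(LCM). -/

section
variable {r l : ℕ}

/-- The truncation of `lcmRatio i ^ β` as a function of residues. -/
noncomputable def residueRatio (β : ℝ) (m : ℕ) (z : Fin r → ZMod (truncModulus m)) : ℝ :=
  lcmRatio (fun k => (z k).val.gcd (truncModulus m)) ^ β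

theorem residueRatio_natCast (β : ℝ) (m : ℕ) (i : Fin r → ℕ) :
    residueRatio β m (fun k => (i k : ZMod (truncModulus m))) =
      lcmRatio (fun k => (i k).gcd (truncModulus m)) ^ β := by
  unfold residueRatio
  congr 2
  funext k
  rw [ZMod.val_natCast]
  exact (Nat.mod_modEq _ _).gcd_eq

open scoped Classical in
theorem IsDown.abs_sum_lcmRatio_sub_le {R : Finset (Fin r → ℕ)} (hR : IsDown R)
    {v : (Fin r → ℕ) → ℝ} (hv0 : ∀ i ∈ R, 0 ≤ v i) (hv1 : ∀ i ∈ R, v i ≤ 1) {β : ℝ} (hβ : 0 < β)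
    (m : ℕ) :
    |∑ i ∈ R, v i * lcmRatio i ^ β -
      ∑ i ∈ R, v i * residueRatio β m (fun k => (i k : ZMod (truncModulus m)))| ≤
      (R.filter fun i => IsExceptional m i).card := by
  rw [← Finset.sum_sub_distrib, Finset.card_filter]
  push_cast
  refine (Finset.abs_sum_le_sum_abs _ _).trans (Finset.sum_le_sum fun i hi => ?_)
  rw [residueRatio_natCast, ← mul_sub, abs_mul, abs_of_nonneg (hv0 i hi)]
  split_ifs with h
  · refine mul_le_one₀ (hv1 i hi) (abs_nonneg _) ?_
    have a1 := lcmRatio_rpow_le_one hβ i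
    have a2 := lcmRatio_rpow_nonneg (β := β) i
    have b1 := lcmRatio_rpow_le_one hβ fun k => (i k).gcd (truncModulus m)
    have b2 := lcmRatio_rpow_nonneg (β := β) fun k => (i k).gcd (truncModulus m)
    rw [abs_le]
    constructor <;> linarith
  · rw [lcmRatio_gcd (fun k => Nat.one_le_iff_ne_zero.1 (hR.pos i hi k)) h]
    simp

/-- The weight v = (product/t)^β increases with the coordinates, whereas equidistribution asks for
decreasing weights. It is applied to 1 and to 1 - v and the results subtracted, hence the factor 2.
-/
theorem abs_sum_weighted_sub_le (hl : 1 ≤ l) (hlr : l ≤ r) {β : ℝ} (hβ : 0 < β) (m n : ℕ) :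
    |∑ i ∈ region l r n, (((∏ k, i k : ℕ) : ℝ) / (n : ℝ) ^ ((r : ℝ) / (l : ℝ))) ^ β *
        residueRatio β m (fun k => (i k : ZMod (truncModulus m))) -
      ((∑ z : Fin r → ZMod (truncModulus m), residueRatio β m z) / (truncModulus m : ℝ) ^ r) *
        ∑ i ∈ region l r n, (((∏ k, i k : ℕ) : ℝ) / (n : ℝ) ^ ((r : ℝ) / (l : ℝ))) ^ β| ≤
      2 * ((region l r n).filter fun i => ∃ k, i k ≤ truncModulus m).card := by
  have hR := isDown_region hl hlr n
  set R := region l r n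
  set t := (n : ℝ) ^ ((r : ℝ) / (l : ℝ))
  set v : (Fin r → ℕ) → ℝ := fun i => (((∏ k, i k : ℕ) : ℝ) / t) ^ β with hv
  have ht : 0 ≤ t := by positivity
  have hv0 : ∀ i, 0 ≤ v i := fun i => by positivity
  have hv1 : ∀ i ∈ R, v i ≤ 1 := fun i hi =>
    Real.rpow_le_one (by positivity) (div_le_one_of_le₀ (prod_le_rpow hl hlr hi) ht) hβ.le
  have hvm : ∀ i ∈ R, ∀ j ∈ R, i ≤ j → 1 - v j ≤ 1 - v i := by
    intro i _ j _ hij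
    refine sub_le_sub_left (Real.rpow_le_rpow (by positivity) ?_ hβ.le) 1
    refine div_le_div_of_nonneg_right ?_ ht
    exact_mod_cast Finset.prod_le_prod' fun k _ => hij k
  have h0 : ∀ z : Fin r → ZMod (truncModulus m), 0 ≤ residueRatio β m z :=
    fun z => lcmRatio_rpow_nonneg _
  have h1 : ∀ z : Fin r → ZMod (truncModulus m), residueRatio β m z ≤ 1 :=
    fun z => lcmRatio_rpow_le_one hβ _
  have e1 := hR.equidistribution (v := fun _ => 1) (fun _ _ => zero_le_one)
    (fun _ _ _ _ _ => le_rfl) h0 h1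
  have e2 := hR.equidistribution (v := fun i => 1 - v i) (fun i hi => sub_nonneg.2 (hv1 i hi))
    hvm h0 h1
  have e3 : ∑ i ∈ R with ∃ k, i k ≤ truncModulus m, (1 - v i) ≤
      ((R.filter fun i => ∃ k, i k ≤ truncModulus m).card : ℝ) := by
    rw [← nsmul_one, ← Finset.sum_const]
    exact Finset.sum_le_sum fun i _ => sub_le_self _ (hv0 i)
  simp only [sub_mul, one_mul, Finset.sum_sub_distrib, mul_sub] at e2
  simp only [one_mul] at e1
  rw [Finset.sum_const (1 : ℝ), nsmul_one] at e1
  rw [Finset.sum_sub_distrib] at e3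
  simp only [Finset.sum_const, nsmul_one] at e1 e2 e3
  rw [abs_le] at *
  constructor <;> linarith

/-- The asymptotics of the moments of the least common multiple, given the mean of the truncated
arithmetic factor. -/
theorem tendsto_lcm_moment (hr : 2 ≤ r) (hl : 1 ≤ l) (hlr : l ≤ r) {β : ℝ} (hβ : 0 < β) {E : ℝ}
    (hE : Tendsto (fun m => (∑ z : Fin r → ZMod (truncModulus m), residueRatio β m z) /
      (truncModulus m : ℝ) ^ r) atTop (𝓝 E)) :
    Tendsto (fun n : ℕ => (∑ i ∈ region l r n,
      (((Finset.univ.lcm i : ℕ) : ℝ) / (n : ℝ) ^ ((r : ℝ) / (l : ℝ))) ^ β) / (region l r n).card)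
      atTop (𝓝 ((∫ x, x ^ β ∂limitLaw l r) * E)) := by
  classical
  rw [Metric.tendsto_nhds]
  intro ε hε
  -- The truncation m is fixed before n: it costs ε/4 for exceptional points and ε/4 for replacing
  -- the mean M by E. For this m, large n brings slab and moment errors below ε/2 together.
  obtain ⟨m, ⟨hm1, hm2⟩, hm3⟩ := (((tendsto_exceptional_bound r).eventually
    (gt_mem_nhds (show 0 < ε / 4 by positivity))).and (Metric.tendsto_nhds.1 hE (ε / 4)
      (by positivity)) |>.and (eventually_ge_atTop 1)).exists
  set M := (∑ z : Fin r → ZMod (truncModulus m), residueRatio β m z) /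
      (truncModulus m : ℝ) ^ r with hM
  set μ := ∫ x, x ^ β ∂limitLaw l r with hμ
  have hmom := tendsto_moment hr hl hlr hβ
  have hslab := tendsto_slab hr hl hlr (truncModulus m)
  rw [← hμ, tendsto_iff_dist_tendsto_zero] at hmom
  have hsmall := (hslab.const_mul 2).add (hmom.const_mul |E|)
  simp only [mul_zero, add_zero] at hsmall
  filter_upwards [hsmall.eventually (gt_mem_nhds (half_pos hε)), eventually_region_card_pos hl hlr]
    with n hn hc
  have hR := isDown_region hl hlr n
  have e2 := abs_sum_weighted_sub_le hl hlr hβ m n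
  rw [← hM] at e2
  set R := region l r n
  set t := (n : ℝ) ^ ((r : ℝ) / (l : ℝ)) with ht
  have ht0 : 0 ≤ t := by positivity
  set v : (Fin r → ℕ) → ℝ := fun i => (((∏ k, i k : ℕ) : ℝ) / t) ^ β with hv
  have hv0 : ∀ i, 0 ≤ v i := fun i => by positivity
  have hv1 : ∀ i ∈ R, v i ≤ 1 := fun i hi =>
    Real.rpow_le_one (by positivity) (div_le_one_of_le₀ (prod_le_rpow hl hlr hi) ht0) hβ.le
  have hsplit : ∑ i ∈ R, (((Finset.univ.lcm i : ℕ) : ℝ) / t) ^ β = ∑ i ∈ R, v i * lcmRatio i ^ β := by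
    refine Finset.sum_congr rfl fun i hi => ?_
    have hp : ((∏ k, i k : ℕ) : ℝ) ≠ 0 := by
      exact_mod_cast prod_ne_zero_of_forall fun k => Nat.one_le_iff_ne_zero.1 (hR.pos i hi k)
    rw [hv, ← Real.mul_rpow (by positivity) (lcmRatio_nonneg i), lcmRatio]
    congr 1
    field_simp
  have e1 := (hR.abs_sum_lcmRatio_sub_le (fun i _ => hv0 i) hv1 hβ m).trans
    (hR.card_exceptional_le hm3)
  change |∑ i ∈ R, v i * _ - M * ∑ i ∈ R, v i| ≤ _ at e2
  change 2 * (_ / (R.card : ℝ)) + |E| * dist ((∑ i ∈ R, v i) / (R.card : ℝ)) μ < _ at hn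
  rw [hsplit]
  set A := ∑ i ∈ R, v i * lcmRatio i ^ β
  set A' := ∑ i ∈ R, v i * residueRatio β m (fun k => (i k : ZMod (truncModulus m)))
  set V := ∑ i ∈ R, v i with hV
  set c : ℝ := (R.card : ℝ) with hcdef
  set s : ℝ := ((R.filter fun i => ∃ k, i k ≤ truncModulus m).card : ℝ)
  set η := (r : ℝ) * (m * (1 / 2 ^ (m + 1))) + r * (r * (1 / m))
  have f1 : |A / c - A' / c| ≤ η := by
    rw [← sub_div, abs_div, abs_of_pos hc, div_le_iff₀ hc, mul_comm]
    exact e1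
  have f2 : |A' / c - M * (V / c)| ≤ 2 * (s / c) := by
    rw [← mul_div_assoc, ← sub_div, abs_div, abs_of_pos hc, ← mul_div_assoc]
    exact div_le_div_of_nonneg_right e2 hc.le
  have hV1 : |V / c| ≤ 1 := by
    have hV0 : 0 ≤ V := Finset.sum_nonneg fun i _ => hv0 i
    rw [abs_of_nonneg (by positivity), div_le_one hc, hcdef, ← nsmul_one, ← Finset.sum_const]
    exact Finset.sum_le_sum hv1
  have f3 : |M * (V / c) - E * (V / c)| ≤ ε / 4 := by
    rw [← sub_mul, abs_mul]
    rw [Real.dist_eq] at hm2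
    exact (mul_le_of_le_one_right (abs_nonneg _) hV1).trans hm2.le
  have f4 : |E * (V / c) - μ * E| = |E| * dist (V / c) μ := by
    rw [Real.dist_eq, ← abs_mul]
    congr 1
    ring
  rw [Real.dist_eq]
  have g1 := abs_sub_le (A / c) (A' / c) (μ * E)
  have g2 := abs_sub_le (A' / c) (M * (V / c)) (μ * E)
  have g3 := abs_sub_le (M * (V / c)) (E * (V / c)) (μ * E)
  linarith only [f1, f2, f3, f4, g1, g2, g3, hm1, hn]

/-- The average of a regularly varying function of the least common multiple. -/
theorem tendsto_lcmAverage_div (hr : 2 ≤ r) (hl : 1 ≤ l) (hlr : l ≤ r) {f : ℝ → ℝ} {β : ℝ}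
    (hfb : LocallyBounded f) (hβ : 0 < β) (hf : RegularlyVarying f β) {E : ℝ}
    (hE : Tendsto (fun m => (∑ z : Fin r → ZMod (truncModulus m), residueRatio β m z) /
      (truncModulus m : ℝ) ^ r) atTop (𝓝 E)) :
    Tendsto (fun n : ℕ => lcmAverage f l r n / f ((n : ℝ) ^ ((r : ℝ) / (l : ℝ)))) atTop
      (𝓝 ((∫ x, x ^ β ∂limitLaw l r) * E)) := by
  have hl0 : (0 : ℝ) < l := by exact_mod_cast hl
  have hr0 : (0 : ℝ) < r := by
    have : 0 < r := by omega
    exact_mod_cast this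
  have htop : Tendsto (fun n : ℕ => (n : ℝ) ^ ((r : ℝ) / (l : ℝ))) atTop atTop :=
    (tendsto_rpow_atTop (by positivity)).comp tendsto_natCast_atTop_atTop
  have hlim := tendsto_lcm_moment hr hl hlr hβ hE
  rw [Metric.tendsto_nhds] at hlim ⊢
  intro ε hε
  filter_upwards [hlim (ε / 2) (half_pos hε),
    htop.eventually (hf.uniform hβ hfb (half_pos hε)),
    htop.eventually_gt_atTop 0, eventually_region_card_pos hl hlr] with n h1 h2 ht hc
  have hR := isDown_region hl hlr n
  have hprod := fun i hi => prod_le_rpow (n := n) hl hlr (i := i) hi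
  rw [lcmAverage]
  set R := region l r n
  set t := (n : ℝ) ^ ((r : ℝ) / (l : ℝ))
  set c : ℝ := (R.card : ℝ) with hcdef
  -- Uniform regular variation is applied at c = LCM/t, which is in (0, 1] since the lcm is at most
  -- the product.
  have h3 : |(∑ i ∈ R, f ((Finset.univ.lcm i : ℕ) : ℝ)) / c / f t -
      (∑ i ∈ R, (((Finset.univ.lcm i : ℕ) : ℝ) / t) ^ β) / c| ≤ ε / 2 := by
    rw [div_right_comm, ← sub_div, abs_div, abs_of_pos hc, div_le_iff₀ hc, Finset.sum_div,
      ← Finset.sum_sub_distrib, mul_comm, hcdef, ← nsmul_eq_mul, ← Finset.sum_const]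
    refine (Finset.abs_sum_le_sum_abs _ _).trans (Finset.sum_le_sum fun i hi => ?_)
    have hi0 : ∀ k, i k ≠ 0 := fun k => Nat.one_le_iff_ne_zero.1 (hR.pos i hi k)
    have hlpos : (0 : ℝ) < ((Finset.univ.lcm i : ℕ) : ℝ) := by
      exact_mod_cast Nat.pos_of_ne_zero (lcm_ne_zero_of_forall hi0)
    have hle : ((Finset.univ.lcm i : ℕ) : ℝ) ≤ t := by
      refine le_trans ?_ (hprod i hi)
      exact_mod_cast Nat.le_of_dvd (Nat.pos_of_ne_zero (prod_ne_zero_of_forall hi0))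
        (Finset.lcm_dvd_prod _ _)
    have := h2 (((Finset.univ.lcm i : ℕ) : ℝ) / t) ⟨by positivity, (div_le_one ht).2 hle⟩
    rwa [div_mul_cancel₀ _ ht.ne'] at this
  rw [Real.dist_eq] at h1 ⊢
  exact (abs_sub_le _ _ _).trans_lt ((add_lt_add_of_le_of_lt h3 h1).trans_eq (add_halves ε))

end

/-! ### Geometric exponents and the random prime product. -/

instance (p : Nat.Primes) : IsProbabilityMeasure (geomLaw p) := by
  unfold geomLaw
  infer_instance

theorem geomLaw_real_singleton (p : Nat.Primes) (j : ℕ) :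
    (geomLaw p).real {j} = (1 - 1 / ((p : ℕ) : ℝ)) * (1 / ((p : ℕ) : ℝ) ^ j) := by
  have hp : (1 : ℝ) ≤ (p : ℕ) := by exact_mod_cast p.2.one_le
  rw [Measure.real, geomLaw_singleton, ENNReal.toReal_ofReal]
  refine mul_nonneg (sub_nonneg.2 ?_) (by positivity)
  rw [div_le_one (by linarith)]
  exact hp

theorem geomLaw_real_ge (p : Nat.Primes) (m : ℕ) :
    (geomLaw p).real {x | m ≤ x} = 1 / ((p : ℕ) : ℝ) ^ m := by
  have hp : (1 : ℝ) < (p : ℕ) := by exact_mod_cast p.2.one_lt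
  have h : {x | m ≤ x} = (↑(Finset.range m) : Set ℕ)ᶜ := by
    ext x
    simp
  rw [h, probReal_compl_eq_one_sub (Finset.measurableSet _), ← sum_measureReal_singleton]
  simp only [geomLaw_real_singleton]
  induction m with
  | zero => simp
  | succ m ih =>
    rw [Finset.sum_range_succ, ← sub_sub, ih (by ext x; simp), pow_succ]
    field_simp
    ring

/-- Among residues modulo p^m, exactly φ(p^(m-a)) have gcd p^a with p^m. So a geometric variable
truncated at m has exactly the law of the exponent of p in the gcd of p^m with a uniform residue. -/
theorem geomLaw_real_min (p : Nat.Primes) {m a : ℕ} (ha : a ≤ m) :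
    (geomLaw p).real {x | min x m = a} =
      (Nat.totient ((p : ℕ) ^ (m - a)) : ℝ) / ((p : ℕ) : ℝ) ^ m := by
  have hp : (1 : ℝ) < (p : ℕ) := by exact_mod_cast p.2.one_lt
  rcases ha.lt_or_eq with h | rfl
  · have hs : {x | min x m = a} = {a} := by
      ext x
      simp only [Set.mem_ofPred_eq, Set.mem_singleton_iff]
      omega
    rw [hs, geomLaw_real_singleton, Nat.totient_prime_pow p.2 (by omega)]
    push_cast [p.2.one_le]
    have hm : m = (m - a - 1) + a + 1 := by omega
    have : ((p : ℕ) : ℝ) ^ m = ((p : ℕ) : ℝ) ^ (m - a - 1) * ((p : ℕ) : ℝ) ^ a * (p : ℕ) := by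
      rw [← pow_add, ← pow_succ, ← hm]
    rw [this]
    field_simp
  · have hs : {x | min x a = a} = {x | a ≤ x} := by
      ext x
      simp
    rw [hs, geomLaw_real_ge]
    simp

theorem coprime_prime_pow {p q : Nat.Primes} (h : p ≠ q) (a b : ℕ) :
    ((p : ℕ) ^ a).Coprime ((q : ℕ) ^ b) :=
  Nat.Coprime.pow _ _ ((Nat.coprime_primes p.2 q.2).2 fun h' => h (Subtype.ext h'))

theorem totient_primePowers (S : Finset Nat.Primes) (a : Nat.Primes → ℕ) :
    Nat.totient (primePowers S a) = ∏ p ∈ S, Nat.totient ((p : ℕ) ^ a p) := by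
  classical
  unfold primePowers
  induction S using Finset.induction_on with
  | empty => simp
  | insert q S hq ih =>
    rw [Finset.prod_insert hq, Finset.prod_insert hq, Nat.totient_mul, ih]
    refine Nat.Coprime.prod_right fun p hp => coprime_prime_pow ?_ _ _
    rintro rfl
    exact hq hp

theorem totient_div_primePowers {S : Finset Nat.Primes} {m e : ℕ}
    (he : e ∣ primePowers S fun _ => m) :
    Nat.totient ((primePowers S fun _ => m) / e) =
      ∏ p ∈ S, Nat.totient ((p : ℕ) ^ (m - e.factorization p)) := by
  obtain ⟨h1, h2⟩ := eq_primePowers_of_dvd he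
  rw [← totient_primePowers]
  congr 1
  have he0 : 0 < e := Nat.pos_of_ne_zero (ne_zero_of_dvd_ne_zero (primePowers_ne_zero _ _) he)
  refine Nat.div_eq_of_eq_mul_left he0 ?_
  have h3 : primePowers S (fun _ => m) = primePowers S (fun p => m - e.factorization p) *
      primePowers S fun p => e.factorization p := by
    simp only [primePowers]
    rw [← Finset.prod_mul_distrib]
    refine Finset.prod_congr rfl fun p hp => ?_
    rw [← pow_add, Nat.sub_add_cancel (h2 p hp)]
  rw [← h1] at h3
  exact h3

section
variable {r : ℕ}

/-- Averages of functions of greatest common divisors over residues. -/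
theorem sum_gcd_eq (Q : ℕ) [NeZero Q] (Ψ : (Fin r → ℕ) → ℝ) :
    ∑ z : Fin r → ZMod Q, Ψ (fun k => (z k).val.gcd Q) =
      ∑ e ∈ Fintype.piFinset fun _ => Q.divisors, Ψ e * ∏ k, (Nat.totient (Q / e k) : ℝ) := by
  have hQ : Q ≠ 0 := NeZero.ne Q
  have hone : ∀ d ∈ Q.divisors,
      (Finset.univ.filter fun x : ZMod Q => x.val.gcd Q = d).card = Nat.totient (Q / d) := by
    intro d hd
    rw [Nat.totient_div_of_dvd (Nat.dvd_of_mem_divisors hd)]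
    refine Finset.card_bij' (fun x _ => x.val) (fun k _ => (k : ZMod Q)) ?_ ?_ ?_ ?_
    · intro x hx
      simp only [Finset.mem_filter, Finset.mem_univ, true_and, Finset.mem_range] at hx ⊢
      exact ⟨ZMod.val_lt x, by rw [Nat.gcd_comm]; exact hx⟩
    · intro k hk
      simp only [Finset.mem_filter, Finset.mem_univ, true_and, Finset.mem_range] at hk ⊢
      rw [ZMod.val_natCast_of_lt hk.1, Nat.gcd_comm]
      exact hk.2
    · intro x _
      simp
    · intro k hk
      simp only [Finset.mem_filter, Finset.mem_range] at hk
      exact ZMod.val_natCast_of_lt hk.1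
  rw [← Finset.sum_fiberwise_of_maps_to (s := Finset.univ)
    (t := Fintype.piFinset fun _ : Fin r => Q.divisors)
    (g := fun z : Fin r → ZMod Q => fun k => (z k).val.gcd Q) (by
      intro z _
      simp [Fintype.mem_piFinset, Nat.gcd_dvd_right, hQ])]
  refine Finset.sum_congr rfl fun e he => ?_
  have hset : (Finset.univ.filter fun z : Fin r → ZMod Q => (fun k => (z k).val.gcd Q) = e) =
      Fintype.piFinset fun k => Finset.univ.filter fun x : ZMod Q => x.val.gcd Q = e k := by
    ext z
    simp [Fintype.mem_piFinset, funext_iff]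
  rw [Finset.sum_congr rfl (g := fun _ => Ψ e) (by
    intro z hz
    rw [(Finset.mem_filter.1 hz).2]), Finset.sum_const, hset, Fintype.card_piFinset,
    nsmul_eq_mul, mul_comm]
  push_cast
  congr 1
  refine Finset.prod_congr rfl fun k _ => ?_
  rw [hone (e k) (Fintype.mem_piFinset.1 he k)]

variable {Ω : Type*} {G : Fin r → Nat.Primes → Ω → ℕ}

/-- The random integers with exponents given by truncated geometric variables. -/
def truncPoint (G : Fin r → Nat.Primes → Ω → ℕ) (m : ℕ) (ω : Ω) : Fin r → ℕ :=
  fun k => primePowers (primesUpTo m) fun p => min (G k p ω) m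

theorem truncPoint_mem (m : ℕ) (ω : Ω) :
    truncPoint G m ω ∈ Fintype.piFinset fun _ : Fin r => (truncModulus m).divisors := by
  rw [Fintype.mem_piFinset]
  intro k
  rw [Nat.mem_divisors]
  exact ⟨primePowers_dvd fun p _ => min_le_right _ _, primePowers_ne_zero _ _⟩

theorem truncPoint_eq_iff {m : ℕ} {e : Fin r → ℕ} (he : ∀ k, e k ∣ truncModulus m) (ω : Ω) :
    truncPoint G m ω = e ↔
      ∀ x ∈ (Finset.univ : Finset (Fin r)) ×ˢ primesUpTo m,
        min (G x.1 x.2 ω) m = (e x.1).factorization x.2 := by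
  have he' := fun k => (eq_primePowers_of_dvd (he k)).1
  constructor
  · rintro h ⟨k, p⟩ hx
    have hp := (Finset.mem_product.1 hx).2
    rw [← h, truncPoint, factorization_primePowers, if_pos hp]
  · intro h
    funext k
    rw [he' k]
    change ∏ p ∈ primesUpTo m, (p : ℕ) ^ min (G k p ω) m =
      ∏ p ∈ primesUpTo m, (p : ℕ) ^ (e k).factorization p
    refine Finset.prod_congr rfl fun p hp => ?_
    rw [h (k, p) (Finset.mem_product.2 ⟨Finset.mem_univ k, hp⟩)]

variable [MeasurableSpace Ω] {P : Measure Ω}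

theorem aemeasurable_truncPoint (hG : ∀ k p, AEMeasurable (G k p) P) (m : ℕ) :
    AEMeasurable (truncPoint G m) P := by
  refine aemeasurable_pi_lambda _ fun k => ?_
  simp only [truncPoint, primePowers]
  refine Finset.aemeasurable_fun_prod _ fun p _ => ?_
  exact (Measurable.of_discrete (f := fun x : ℕ => (p : ℕ) ^ min x m)).comp_aemeasurable (hG k p)

/-- Independence over pairs (k, p) and multiplicativity of φ. The right side is the proportion of
residue vectors whose gcds with the modulus are e. -/
theorem prob_truncPoint_eq (hG : ∀ k p, HasLaw (G k p) (geomLaw p) P)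
    (hGindep : iIndepFun (fun (kp : Fin r × Nat.Primes) => G kp.1 kp.2) P) {m : ℕ}
    {e : Fin r → ℕ} (he : ∀ k, e k ∣ truncModulus m) :
    P.real {ω | truncPoint G m ω = e} =
      ∏ k, ((Nat.totient (truncModulus m / e k) : ℝ) / (truncModulus m : ℝ)) := by
  have hset : {ω | truncPoint G m ω = e} =
      ⋂ x ∈ (Finset.univ : Finset (Fin r)) ×ˢ primesUpTo m,
        (fun ω => G x.1 x.2 ω) ⁻¹' {y | min y m = (e x.1).factorization x.2} := by
    ext ω
    simp only [Set.mem_ofPred_eq, truncPoint_eq_iff he, Set.mem_iInter, Set.mem_preimage]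
  rw [hset, Measure.real, hGindep.measure_inter_preimage_eq_mul _
    (fun x _ => MeasurableSet.of_discrete), ENNReal.toReal_prod, Finset.prod_product]
  refine Finset.prod_congr rfl fun k _ => ?_
  rw [truncModulus, totient_div_primePowers (he k)]
  simp only [primePowers]
  push_cast
  rw [← Finset.prod_div_distrib]
  refine Finset.prod_congr rfl fun p hp => ?_
  have hle := (eq_primePowers_of_dvd (he k)).2 p hp
  rw [← geomLaw_real_min p hle]
  exact (hG k p).measureReal_eq MeasurableSet.of_discrete

/-- Borel-Cantelli: a prime p divides two given random coordinates with probability p^(-2), which is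
summable. -/
theorem ae_finite_common_primes (hG : ∀ k p, HasLaw (G k p) (geomLaw p) P)
    (hGindep : iIndepFun (fun (kp : Fin r × Nat.Primes) => G kp.1 kp.2) P) :
    ∀ᵐ ω ∂P, {p | ∃ j k, j ≠ k ∧ 1 ≤ G j p ω ∧ 1 ≤ G k p ω}.Finite := by
  have hpair : ∀ j k : Fin r, j ≠ k → ∀ᵐ ω ∂P, {p | 1 ≤ G j p ω ∧ 1 ≤ G k p ω}.Finite := by
    intro j k hjk
    have hprob : ∀ p, P {ω | 1 ≤ G j p ω ∧ 1 ≤ G k p ω} =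
        ENNReal.ofReal (((p : ℕ) : ℝ) ^ (-2 : ℝ)) := by
      intro p
      have hind : IndepFun (G j p) (G k p) P :=
        hGindep.indepFun (i := (j, p)) (j := (k, p)) (fun h => hjk (congrArg Prod.fst h))
      have h1 := hind.measure_inter_preimage_eq_mul {x | 1 ≤ x} {x | 1 ≤ x}
        MeasurableSet.of_discrete MeasurableSet.of_discrete
      have h2 : ∀ k, P (G k p ⁻¹' {x | 1 ≤ x}) = ENNReal.ofReal (1 / ((p : ℕ) : ℝ) ^ 1) := by
        intro k
        rw [← geomLaw_real_ge, ofReal_measureReal]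
        exact (hG k p).measure_eq MeasurableSet.of_discrete
      have h3 : {ω | 1 ≤ G j p ω ∧ 1 ≤ G k p ω} = G j p ⁻¹' {x | 1 ≤ x} ∩ G k p ⁻¹' {x | 1 ≤ x} :=
        rfl
      rw [h3, h1, h2, h2, ← ENNReal.ofReal_mul (by positivity)]
      congr 1
      rw [Real.rpow_neg (by positivity), show (2 : ℝ) = ((2 : ℕ) : ℝ) by norm_num,
        Real.rpow_natCast]
      field_simp
    refine ae_finite_setOfPred_mem (s := fun p => {ω | 1 ≤ G j p ω ∧ 1 ≤ G k p ω}) ?_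
    simp only [hprob]
    exact (Nat.Primes.summable_rpow.2 (by norm_num)).tsum_ofReal_ne_top
  have hall : ∀ᵐ ω ∂P, ∀ j k : Fin r, j ≠ k → {p | 1 ≤ G j p ω ∧ 1 ≤ G k p ω}.Finite := by
    rw [ae_all_iff]
    intro j
    rw [ae_all_iff]
    intro k
    by_cases h : j = k
    · simp [h]
    · filter_upwards [hpair j k h] with ω hω _
      exact hω
  filter_upwards [hall] with ω hω
  have : {p | ∃ j k, j ≠ k ∧ 1 ≤ G j p ω ∧ 1 ≤ G k p ω} =
      ⋃ j, ⋃ k, ⋃ _ : j ≠ k, {p | 1 ≤ G j p ω ∧ 1 ≤ G k p ω} := by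
    ext p
    simp only [Set.mem_ofPred_eq, Set.mem_iUnion, exists_prop]
  rw [this]
  exact Set.finite_iUnion fun j => Set.finite_iUnion fun k => Set.finite_iUnion fun h => hω j k h

theorem zpow_sup_sub_sum_eq_one {x : Fin r → ℕ} (h : ∀ j k, j ≠ k → x j = 0 ∨ x k = 0) (y : ℝ) :
    y ^ (((Finset.univ.sup x : ℕ) : ℤ) - ∑ k, (x k : ℤ)) = 1 := by
  rw [sup_eq_sum_of_pairwise h]
  simp

/-- If only finitely many primes have two positive exponents, the prime product is a finite product
and agrees with the truncated ratios. -/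
theorem primeProduct_eq_eventually {g : Fin r → Nat.Primes → ℕ}
    (h : {p | ∃ j k, j ≠ k ∧ 1 ≤ g j p ∧ 1 ≤ g k p}.Finite) :
    0 < primeProduct g ∧ ∀ᶠ m in atTop,
      lcmRatio (fun k => primePowers (primesUpTo m) fun p => min (g k p) m) = primeProduct g := by
  set T := h.toFinset with hT
  have hnot : ∀ p ∉ T, ∀ j k, j ≠ k → g j p = 0 ∨ g k p = 0 := by
    intro p hp j k hjk
    by_contra! hne
    exact hp (h.mem_toFinset.2 ⟨j, k, hjk, Nat.one_le_iff_ne_zero.2 hne.1,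
      Nat.one_le_iff_ne_zero.2 hne.2⟩)
  have hprod : primeProduct g = ∏ p ∈ T, ((p : ℕ) : ℝ) ^
      (((Finset.univ.sup fun k => g k p : ℕ) : ℤ) - ∑ k, (g k p : ℤ)) :=
    tprod_eq_prod fun p hp => zpow_sup_sub_sum_eq_one (hnot p hp) _
  constructor
  · rw [hprod]
    refine Finset.prod_pos fun p _ => zpow_pos ?_ _
    exact_mod_cast p.2.pos
  · have hT1 : ∀ᶠ m in atTop, ∀ p ∈ T, (p : ℕ) ≤ m ∧ ∀ k, g k p ≤ m := by
      rw [Filter.eventually_all_finset]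
      intro p _
      exact (eventually_ge_atTop _).and (eventually_all.2 fun k => eventually_ge_atTop _)
    filter_upwards [hT1] with m hm
    rw [lcmRatio_primePowers, hprod]
    symm
    have hsub : T ⊆ primesUpTo m := fun p hp => mem_primesUpTo.2 (hm p hp).1
    rw [Finset.prod_congr rfl (g := fun p : Nat.Primes => ((p : ℕ) : ℝ) ^
      (((Finset.univ.sup fun k => min (g k p) m : ℕ) : ℤ) - ∑ k, ((min (g k p) m : ℕ) : ℤ))) (by
        intro p hp
        simp only [min_eq_left ((hm p hp).2 _)])]
    refine Finset.prod_subset hsub fun p _ hp => zpow_sup_sub_sum_eq_one (fun j k hjk => ?_) _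
    rcases hnot p hp j k hjk with h | h <;> simp [h]

theorem tendsto_lcmRatio_truncPoint (hG : ∀ k p, HasLaw (G k p) (geomLaw p) P)
    (hGindep : iIndepFun (fun (kp : Fin r × Nat.Primes) => G kp.1 kp.2) P) (β : ℝ) :
    ∀ᵐ ω ∂P, 0 < primeProduct (fun k p => G k p ω) ∧
      Tendsto (fun m => lcmRatio (truncPoint G m ω) ^ β) atTop
        (𝓝 (primeProduct (fun k p => G k p ω) ^ β)) := by
  filter_upwards [ae_finite_common_primes hG hGindep] with ω hω
  obtain ⟨h1, h2⟩ := primeProduct_eq_eventually (g := fun k p => G k p ω) hω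
  refine ⟨h1, tendsto_const_nhds.congr' ?_⟩
  filter_upwards [h2] with m hm
  rw [← hm]
  rfl

variable [IsProbabilityMeasure P]

/-- The mean of a function of the truncated random integers equals a mean over residues. -/
theorem integral_truncPoint (hG : ∀ k p, HasLaw (G k p) (geomLaw p) P)
    (hGindep : iIndepFun (fun (kp : Fin r × Nat.Primes) => G kp.1 kp.2) P) (m : ℕ)
    (Ψ : (Fin r → ℕ) → ℝ) :
    ∫ ω, Ψ (truncPoint G m ω) ∂P =
      (∑ z : Fin r → ZMod (truncModulus m), Ψ (fun k => (z k).val.gcd (truncModulus m))) /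
        (truncModulus m : ℝ) ^ r := by
  classical
  set D := Fintype.piFinset fun _ : Fin r => (truncModulus m).divisors with hD
  have hae := aemeasurable_truncPoint (fun k p => (hG k p).aemeasurable) m
  have hnull : ∀ e : Fin r → ℕ, NullMeasurableSet {ω | truncPoint G m ω = e} P := fun e =>
    hae.nullMeasurableSet_preimage (measurableSet_singleton e)
  have hexp : ∀ ω, Ψ (truncPoint G m ω) =
      ∑ e ∈ D, {ω | truncPoint G m ω = e}.indicator (fun _ => Ψ e) ω := by
    intro ω
    rw [Finset.sum_eq_single (truncPoint G m ω)]
    · rw [Set.indicator_of_mem (by rfl)]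
    · intro e _ hne
      exact Set.indicator_of_notMem (fun h => hne h.symm) _
    · exact fun h => absurd (truncPoint_mem m ω) h
  simp only [hexp]
  rw [integral_finsetSum, sum_gcd_eq, Finset.sum_div]
  · refine Finset.sum_congr rfl fun e he => ?_
    have hdvd : ∀ k, e k ∣ truncModulus m := fun k =>
      Nat.dvd_of_mem_divisors (Fintype.mem_piFinset.1 he k)
    rw [integral_indicator₀ (hnull e), setIntegral_const, prob_truncPoint_eq hG hGindep hdvd,
      Finset.prod_div_distrib, Finset.prod_const, Finset.card_univ, Fintype.card_fin, smul_eq_mul]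
    ring
  · intro e _
    exact (integrable_const (Ψ e)).indicator₀ (hnull e)

/-- The residue mean is the expectation of the truncated ratio, which converges almost surely and is
bounded by 1. Positivity of the limit allows the final division. -/
theorem tendsto_mean_residueRatio (hG : ∀ k p, HasLaw (G k p) (geomLaw p) P)
    (hGindep : iIndepFun (fun (kp : Fin r × Nat.Primes) => G kp.1 kp.2) P) {β : ℝ} (hβ : 0 < β) :
    Tendsto (fun m => (∑ z : Fin r → ZMod (truncModulus m), residueRatio β m z) /
      (truncModulus m : ℝ) ^ r) atTop
      (𝓝 (∫ ω, primeProduct (fun k p => G k p ω) ^ β ∂P)) ∧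
    0 < ∫ ω, primeProduct (fun k p => G k p ω) ^ β ∂P := by
  have hlim := tendsto_lcmRatio_truncPoint hG hGindep β
  have hmeas : ∀ m, AEStronglyMeasurable (fun ω => lcmRatio (truncPoint G m ω) ^ β) P := fun m =>
    ((Measurable.of_discrete (f := fun i : Fin r → ℕ => lcmRatio i ^ β)).comp_aemeasurable
      (aemeasurable_truncPoint (fun k p => (hG k p).aemeasurable) m)).aestronglyMeasurable
  constructor
  · have : Tendsto (fun m => ∫ ω, lcmRatio (truncPoint G m ω) ^ β ∂P) atTop
        (𝓝 (∫ ω, primeProduct (fun k p => G k p ω) ^ β ∂P)) := by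
      refine tendsto_integral_of_dominated_convergence (fun _ => 1) hmeas (integrable_const 1)
        (fun m => ae_of_all _ fun ω => ?_) (hlim.mono fun ω h => h.2)
      rw [Real.norm_of_nonneg (lcmRatio_rpow_nonneg _)]
      exact lcmRatio_rpow_le_one hβ _
    refine this.congr fun m => ?_
    exact integral_truncPoint hG hGindep m fun i => lcmRatio i ^ β
  · have hpos : ∀ᵐ ω ∂P, 0 < primeProduct (fun k p => G k p ω) ^ β :=
      hlim.mono fun ω h => Real.rpow_pos_of_pos h.1 β
    have hle : ∀ᵐ ω ∂P, ‖primeProduct (fun k p => G k p ω) ^ β‖ ≤ 1 := by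
      filter_upwards [hlim, hpos] with ω h1 h2
      rw [Real.norm_of_nonneg h2.le]
      exact le_of_tendsto h1.2 (Eventually.of_forall fun m => lcmRatio_rpow_le_one hβ _)
    have hint : Integrable (fun ω => primeProduct (fun k p => G k p ω) ^ β) P :=
      (integrable_const (1 : ℝ)).mono'
        (aestronglyMeasurable_of_tendsto_ae _ hmeas (hlim.mono fun ω h => h.2)) hle
    rw [integral_pos_iff_support_of_nonneg_ae (hpos.mono fun ω h => h.le) hint]
    have : P (Function.support fun ω => primeProduct (fun k p => G k p ω) ^ β) = P Set.univ :=
      measure_congr (by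
        filter_upwards [hpos] with ω h
        exact propext (iff_of_true h.ne' trivial))
    rw [this]
    simp

end
end HyperbolicLCM

theorem mainTheorem3 (r l : ℕ) (hr : 2 ≤ r) (hl : 1 ≤ l) (hlr : l ≤ r)
    {Ω : Type*} [MeasurableSpace Ω] (P : Measure Ω) [IsProbabilityMeasure P]
    (G : Fin r → Nat.Primes → Ω → ℕ)
    (hG : ∀ k p, HasLaw (G k p) (HyperbolicLCM.geomLaw p) P)
    (hGindep : iIndepFun (fun (kp : Fin r × Nat.Primes) => G kp.1 kp.2) P)
    (U : Ω → ℝ) (hU : HasLaw U (HyperbolicLCM.limitLaw l r) P)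
    (f : ℝ → ℝ) (hfb : HyperbolicLCM.LocallyBounded f)
    (β : ℝ) (hβ : 0 < β) (hf : HyperbolicLCM.RegularlyVarying f β) :
    Tendsto
      (fun n : ℕ => HyperbolicLCM.lcmAverage f l r n /
        ((∫ ω, U ω ^ β ∂P) *
          (∫ ω, HyperbolicLCM.primeProduct (fun k p => G k p ω) ^ β ∂P) *
          f ((n : ℝ) ^ ((r : ℝ) / (l : ℝ)))))
      atTop (𝓝 1) := by
  obtain ⟨hE, hEpos⟩ := HyperbolicLCM.tendsto_mean_residueRatio hG hGindep hβ
  have hUint : ∫ ω, U ω ^ β ∂P = ∫ x, x ^ β ∂HyperbolicLCM.limitLaw l r :=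
    hU.integral_comp (f := fun x => x ^ β)
      (Real.continuous_rpow_const hβ.le).aestronglyMeasurable
  have hUpos := HyperbolicLCM.moment_limitLaw_pos hr hl hlr hβ
  have h := (HyperbolicLCM.tendsto_lcmAverage_div hr hl hlr hfb hβ hf hE).div_const
    ((∫ ω, U ω ^ β ∂P) * ∫ ω, HyperbolicLCM.primeProduct (fun k p => G k p ω) ^ β ∂P)
  rw [hUint, div_self (mul_pos hUpos hEpos).ne'] at h
  rw [hUint]
  refine h.congr fun n => ?_
  rw [div_div, mul_comm (f _)]
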